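/- **Conventions.** A ringoid is a small preadditive category; a left module over a ringoid $\mathcal{C}$ is an additive functor from $\mathcal{C}$ to abelian groups, and a map of modules is a natural transformation. Let $\mathcal{R}$ be the ringoid whose objects are the integers and in which $\mathcal{R}(a,b)$ is the $\mathbb{F}_2$-vector space with basis the finite sequences $a=c_1<c_2<\dots<c_m=b$ $(m\ge 1)$, composition being concatenation. For $i>0$ write $\mathrm{Sq}^i\in\mathcal{R}(n,n+i)$ for the sequence $(n,n+i)$, and let $\mathrm{Sq}^0$ be the identity of $n$; a product $\mathrm{Sq}^i\mathrm{Sq}^j\in\mathcal{R}(n,n+i+j)$ is the composite in which $\mathrm{Sq}^j:n\to n+j$ is applied first. Let $\mathcal{Q}$ be the quotient of $\mathcal{R}$ by the two-sided ideal generated by the Adem relations $$\mathrm{Sq}^i\mathrm{Sq}^j-\sum_{t=0}^{\lfloor i/2\rfloor}\binom{j-t-1}{i-2t}\mathrm{Sq}^{i+j-t}\mathrm{Sq}^t\in\mathcal{R}(n,n+i+j)\qquad(n\in\mathbb{Z},\ 0<i<2j)$$ and by the instability conditions $\mathrm{Sq}^i:n\to n+i$ for $i\geq 0$, $i>n$ (so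 the identity of $n$ becomes zero when $n<0$). Left $\mathcal{Q}$-modules are the unstable modules over the mod 2 Steenrod algebra. For $k\ge 0$ let $\mathcal{Q}_k$ be the subringoid of $\mathcal{Q}$ (same objects, morphism sets closed under addition, negation and composition and containing the identities) generated by the top $k$ squares $\mathrm{Sq}_{n-i}=\mathrm{Sq}^i:n\to n+i$ with $i\ge 0$ and $n-i<k$. Let $\mathcal{U}_k$ be the abelian category of left $\mathcal{Q}_k$-modules. **Theorem.** Let $k\ge 0$. 1. For all modules $M,N$ in $\mathcal{U}_k$ and all integers $s>k$, $\mathrm{Ext}^s_{\mathcal{U}_k}(M,N)=0$. 2. Every module $M$ in $\mathcal{U}_k$ has a projective resolution of length at most $k$, that is, a projective resolution $P_\bullet\to M$ with $P_n=0$ for all $n>k$. In other words, the homological dimension of $\mathcal{U}_k$ is at most $k$. -/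

import Mathlib

open CategoryTheory CategoryTheory.Limits

universe u v w

namespace TopSquares

section Ringoids

variable {C : Type u} [Category.{v} C] [Preadditive C]

/-- `IdealClosure S f` means that `f` belongs to the two-sided ideal of the preadditive category
`C` generated by the set of morphisms `S`. -/
inductive IdealClosure (S : MorphismProperty C) : ∀ {x y : C}, (x ⟶ y) → Prop
  | of {x y : C} (f : x ⟶ y) (hf : S f) : IdealClosure S f
  | zero (x y : C) : IdealClosure S (0 : x ⟶ y)
  | add {x y : C} (f g : x ⟶ y) (hf : IdealClosure S f) (hg : IdealClosure S g) :
      IdealClosure S (f + g)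
  | neg {x y : C} (f : x ⟶ y) (hf : IdealClosure S f) : IdealClosure S (-f)
  | comp_left {x y z : C} (f : x ⟶ y) (g : y ⟶ z) (hg : IdealClosure S g) :
      IdealClosure S (f ≫ g)
  | comp_right {x y z : C} (f : x ⟶ y) (g : y ⟶ z) (hf : IdealClosure S f) :
      IdealClosure S (f ≫ g)

/-- Two parallel morphisms are identified when their difference lies in the ideal generated
by `S`. -/
def idealRel (S : MorphismProperty C) : HomRel C := fun _ _ f g => IdealClosure S (f - g)

instance idealRel_congruence (S : MorphismProperty C) : Congruence (idealRel S) where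
  comp_left f g g' h := by
    have := IdealClosure.comp_left f _ h
    rwa [Preadditive.comp_sub] at this
  comp_right g h := by
    have := IdealClosure.comp_right _ g h
    rwa [Preadditive.sub_comp] at this
  equivalence :=
    { refl := fun f => by
        change IdealClosure S (f - f)
        rw [sub_self]
        exact IdealClosure.zero _ _
      symm := fun {f g} h => by
        have := IdealClosure.neg _ h
        rwa [neg_sub] at this
      trans := fun {f g h} h₁ h₂ => by
        have := IdealClosure.add _ _ h₁ h₂
        rwa [sub_add_sub_cancel] at this }

/-- The quotient ringoid of `C` by the ideal generated by `S`. -/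
abbrev IdealQuotient (S : MorphismProperty C) := Quotient (idealRel S)

instance idealQuotientPreadditive (S : MorphismProperty C) : Preadditive (IdealQuotient S) :=
  Quotient.preadditive (idealRel S) (by
    intro X Y f₁ f₂ g₁ g₂ h₁ h₂
    have := IdealClosure.add _ _ h₁ h₂
    rwa [← add_sub_add_comm] at this)

/-- `SubringoidClosure S f` means that `f` belongs to the subringoid of `C` generated by the set of
morphisms `S`: the smallest family of subgroups of the morphism groups that contains `S` and all
identities and is closed under composition. -/
inductive SubringoidClosure (S : MorphismProperty C) : ∀ {x y : C}, (x ⟶ y) → Prop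
  | of {x y : C} (f : x ⟶ y) (hf : S f) : SubringoidClosure S f
  | zero (x y : C) : SubringoidClosure S (0 : x ⟶ y)
  | add {x y : C} (f g : x ⟶ y) (hf : SubringoidClosure S f) (hg : SubringoidClosure S g) :
      SubringoidClosure S (f + g)
  | neg {x y : C} (f : x ⟶ y) (hf : SubringoidClosure S f) : SubringoidClosure S (-f)
  | id (x : C) : SubringoidClosure S (𝟙 x)
  | comp {x y z : C} (f : x ⟶ y) (g : y ⟶ z) (hf : SubringoidClosure S f)
      (hg : SubringoidClosure S g) : SubringoidClosure S (f ≫ g)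

/-- The morphisms of the subringoid generated by `S`. -/
def subringoidHoms (S : MorphismProperty C) : MorphismProperty C :=
  fun _ _ f => SubringoidClosure S f

instance subringoidHoms_isMultiplicative (S : MorphismProperty C) :
    (subringoidHoms S).IsMultiplicative where
  id_mem x := SubringoidClosure.id x
  comp_mem f g hf hg := SubringoidClosure.comp f g hf hg

/-- The subringoid of `C` generated by `S`: all objects of `C`, and the morphisms in
`subringoidHoms S`. -/
abbrev GeneratedSubringoid (S : MorphismProperty C) := WideSubcategory (subringoidHoms S)

/-- The morphism groups of the generated subringoid are subgroups of those of `C`. -/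
instance generatedSubringoidPreadditive (S : MorphismProperty C) :
    Preadditive (GeneratedSubringoid S) where
  homGroup X Y :=
    let iZ : Zero (X ⟶ Y) := ⟨⟨0, SubringoidClosure.zero _ _⟩⟩
    let iA : Add (X ⟶ Y) := ⟨fun f g => ⟨f.hom + g.hom, SubringoidClosure.add _ _ f.2 g.2⟩⟩
    let iN : Neg (X ⟶ Y) := ⟨fun f => ⟨-f.hom, SubringoidClosure.neg _ f.2⟩⟩
    { add_assoc := fun f g h => WideSubcategory.hom_ext _ (add_assoc f.hom g.hom h.hom)
      zero_add := fun f => WideSubcategory.hom_ext _ (zero_add f.hom)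
      add_zero := fun f => WideSubcategory.hom_ext _ (add_zero f.hom)
      add_comm := fun f g => WideSubcategory.hom_ext _ (add_comm f.hom g.hom)
      neg_add_cancel := fun f => WideSubcategory.hom_ext _ (neg_add_cancel f.hom)
      nsmul := nsmulRec
      zsmul := zsmulRec }
  add_comp _ _ _ f f' g :=
    WideSubcategory.hom_ext _ (Preadditive.add_comp _ _ _ f.hom f'.hom g.hom)
  comp_add _ _ _ f g g' :=
    WideSubcategory.hom_ext _ (Preadditive.comp_add _ _ _ f.hom g.hom g'.hom)

end Ringoids

section Modules

variable (C : Type u) [Category.{v} C] [Preadditive C]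

/-- The category of left modules over a ringoid `C`: additive functors from `C` to abelian groups,
with natural transformations as morphisms. -/
abbrev RingoidModule := C ⥤+ AddCommGrpCat.{w}

end Modules

/-- The vertices of the quiver below: the integers, with an edge `a ⟶ b` exactly when `a < b`. -/
structure Degree where
  /-- the underlying integer -/
  val : ℤ

instance : Quiver.{0} Degree where
  Hom a b := PLift (a.val < b.val)

/-- The ringoid with the integers as objects, whose morphisms `a ⟶ b` are the formal
`𝔽₂`-linear combinations of the paths `a = c₁ < c₂ < ⋯ < cₘ = b`. -/
abbrev FreeSquares := Free (ZMod 2) (Paths Degree)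

/-- The integer `n` as an object of `FreeSquares`. -/
noncomputable abbrev FreeSquares.deg (n : ℤ) : FreeSquares :=
  (Free.embedding (ZMod 2) (Paths Degree)).obj ((Paths.of Degree).obj (Degree.mk n))

/-- The square `Sq^{b-a} : a ⟶ b`. It is the one-step path if `a < b`, the identity if `a = b`
(`Sq⁰ = 1`), and zero if `b < a` (negative squares vanish). -/
noncomputable def sq (a b : ℤ) : FreeSquares.deg a ⟶ FreeSquares.deg b :=
  if h : a < b then
    (Free.embedding (ZMod 2) (Paths Degree)).map
      ((Paths.of Degree).map (X := Degree.mk a) (Y := Degree.mk b) (PLift.up h))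
  else if h : a = b then eqToHom (congrArg FreeSquares.deg h)
  else 0

/-- The Adem relation for `Sq^i Sq^j` on degree `n`. The rightmost square acts first. When
`0 < i < 2 * j`, the natural number subtractions below do not truncate. -/
noncomputable def ademRelation (n : ℤ) (i j : ℕ) :
    FreeSquares.deg n ⟶ FreeSquares.deg (n + i + j) :=
  sq n (n + j) ≫ sq (n + j) (n + i + j) -
    ∑ t ∈ Finset.range (i / 2 + 1),
      ((j - t - 1).choose (i - 2 * t)) • (sq n (n + t) ≫ sq (n + t) (n + i + j))

/-- The Adem relations together with the instability conditions `Sq^i = 0` on degree `n` for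
`i > n`. For `n < 0` and `i = 0` the latter says that the identity of `n` is zero. -/
inductive UnstableRelations : MorphismProperty FreeSquares
  | adem (n : ℤ) (i j : ℕ) (hi : 0 < i) (hij : i < 2 * j) :
      UnstableRelations (ademRelation n i j)
  | unstable (n i : ℤ) (h : n < i) : UnstableRelations (sq n (n + i))

/-- The ringoid whose left modules are the unstable modules over the mod 2 Steenrod algebra. -/
abbrev Q := IdealQuotient UnstableRelations

/-- The class in `Q` of the square `Sq^{b-a} : a ⟶ b`. -/
noncomputable def qSq (a b : ℤ) :
    (Quotient.functor (idealRel UnstableRelations)).obj (FreeSquares.deg a) ⟶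
      (Quotient.functor (idealRel UnstableRelations)).obj (FreeSquares.deg b) :=
  (Quotient.functor (idealRel UnstableRelations)).map (sq a b)

/-- The top `k` squares `Sq_{n-i} = Sq^i : n ⟶ n + i`, where `i ≥ 0` and `n - i < k`. -/
inductive TopSquare (k : ℕ) : MorphismProperty Q
  | mk (n i : ℤ) (hi : 0 ≤ i) (h : n - i < k) : TopSquare k (qSq n (n + i))

/-- The subringoid of `Q` generated by the top `k` squares. -/
abbrev Qk (k : ℕ) := GeneratedSubringoid (TopSquare k)

/-- The category `𝒰_k` of unstable modules over the Steenrod algebra with only the top `k`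
squares. -/
abbrev Uk (k : ℕ) := RingoidModule.{0, 0, u} (Qk k)

section AbelianStructure

variable (C : Type u) [Category.{v} C] [Preadditive C]

instance : (additiveFunctor C AddCommGrpCat.{w}).IsClosedUnderSubobjects where
  prop_of_mono {F G} i _ hG := by
    have : G.Additive := hG
    refine ⟨fun {X Y f g} => ?_⟩
    rw [← cancel_mono (i.app Y)]
    simp [Functor.map_add]

instance : (additiveFunctor C AddCommGrpCat.{w}).IsClosedUnderQuotients where
  prop_of_epi {F G} p _ hF := by
    have : F.Additive := hF
    refine ⟨fun {X Y f g} => ?_⟩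
    rw [← cancel_epi (p.app X)]
    simp only [← NatTrans.naturality, Preadditive.comp_add, Functor.map_add, Preadditive.add_comp]

instance : (additiveFunctor C AddCommGrpCat.{w}).ContainsZero where
  exists_zero := by
    obtain ⟨Z, hZ⟩ := HasZeroObject.zero (C := C ⥤ AddCommGrpCat.{w})
    exact ⟨Z, hZ, ⟨fun {X Y f g} => (hZ.obj X).eq_of_src _ _⟩⟩

instance : (additiveFunctor C AddCommGrpCat.{w}).IsClosedUnderFiniteProducts where
  isClosedUnderLimitsOfShape J _ := ⟨by
    rintro F ⟨p⟩
    refine ⟨fun {X Y f g} => ?_⟩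
    have h := isLimitOfPreserves ((evaluation C AddCommGrpCat.{w}).obj Y) p.isLimit
    refine h.hom_ext fun j => ?_
    have : (p.diag.obj j).Additive := p.prop_diag_obj j
    simp [Functor.map_add]⟩

/-- Left modules over a ringoid form an abelian category. -/
noncomputable instance ringoidModuleAbelian : Abelian (RingoidModule.{u, v, w} C) :=
  inferInstanceAs (Abelian (additiveFunctor C AddCommGrpCat.{w}).FullSubcategory)

end AbelianStructure

/-- The universe in which the `Ext` groups of `𝒰_k` are formed. -/
instance ukHasExt (k : ℕ) : HasExt.{u + 1} (Uk.{u} k) := HasExt.standard _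

end TopSquares

/-! Index the square `a ⟶ d` by its lower index `2 * a - d`, and write Sq_j for a square of lower
index j. In a module M let F_j (`filt`) be the subgroups generated by the images of the
degree-raising squares of lower index less than j. The Adem relations show that Sq_j preserves F_j,
so it acts on M/F_j; M is l-regular (`IsRegularSystem`) when these actions are injective for all j <
l. Every module is 0-regular, vacuously, and an l-regular module with l ≤ k has projective dimension
at most k - l. This rests on three facts.

Free modules are k-regular (`freeMod.isRegularSystem`). In a short exact sequence 0 → A → B → C → 0
with B k-regular, C l-regular and l < k, the module A is (l+1)-regular
(`IsRegularSystem.of_shortExact`). A k-regular module is free, hence projective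
(`projective_of_isRegularSystem`). Thus each passage to the kernel of a free cover gains one step of
regularity, and after k - l steps the kernel is projective.

Regularity of free modules is read off from polynomials: `Q` acts on 𝔽₂[x₁, …, x_N], and morphisms
out of N are evaluated on x₁⋯x_N. Partial derivatives commute with squares and lower the degree by
one. So an order-j derivative of Sq^i f, with f of degree m, is Sq^i of a polynomial g of degree m -
j: it is zero if m - j < i, and it is g² if m - j = i. Hence F_j is detected by the vanishing of all
order-j derivatives (`mem_filt_of_derivsVanish`), and Sq_j is injective modulo F_j because squaring
is injective. -/

namespace TopSquares

/-! ### Steenrod squares on polynomial rings over 𝔽₂. -/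

section PolynomialModel

open MvPolynomial

variable {σ : Type}

/-- Homogeneity of polynomials over `𝔽₂`, with degrees taken in the integers. -/
abbrev IsHomog (f : MvPolynomial σ (ZMod 2)) (n : ℤ) : Prop :=
  IsWeightedHomogeneous (fun _ => (1 : ℤ)) f n

theorem IsHomog.induction {T : ℤ → MvPolynomial σ (ZMod 2) → Prop}
    (zero : ∀ n, T n 0) (add : ∀ n f g, T n f → T n g → T n (f + g))
    (const : ∀ c, T 0 (C c)) (var : ∀ p, T 1 (X p))
    (mul : ∀ m n f g, T m f → T n g → T (m + n) (f * g))
    {f : MvPolynomial σ (ZMod 2)} {n : ℤ} (hf : IsHomog f n) : T n f := by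
  have mon : ∀ (e : σ →₀ ℕ) (c : ZMod 2),
      T (Finsupp.weight (fun _ => (1 : ℤ)) e) (monomial e c) := by
    intro e
    induction e using Finsupp.induction_linear with
    | zero => intro c; simpa using const c
    | add e e' h h' =>
      intro c
      have := mul _ _ _ _ (h c) (h' 1)
      rwa [monomial_mul, mul_one, ← map_add] at this
    | single p m =>
      intro c
      have hp : T (m : ℤ) ((X p : MvPolynomial σ (ZMod 2)) ^ m) := by
        induction m with
        | zero => simpa using const 1
        | succ m ih => simpa [pow_succ] using mul _ _ _ _ ih (var p)
      have := mul _ _ _ _ (const c) hp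
      rw [C_mul_X_pow_eq_monomial] at this
      simpa [Finsupp.weight_single] using this
  rw [f.as_sum]
  have : ∀ s ⊆ f.support, T n (∑ e ∈ s, monomial e (coeff e f)) := by
    classical
    intro s
    induction s using Finset.induction_on with
    | empty => intro _; simpa using zero n
    | insert e s he ih =>
      intro hs
      rw [Finset.sum_insert he]
      refine add _ _ _ ?_ (ih fun x hx => hs (Finset.mem_insert_of_mem hx))
      have h1 := hf (mem_support_iff.1 (hs (Finset.mem_insert_self _ _)))
      rw [← h1]
      exact mon _ _
  exact this _ subset_rfl

/-- The total Steenrod square, the ring homomorphism with `x ↦ x + x² z` on the variables. -/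
noncomputable def totalSq :
    MvPolynomial σ (ZMod 2) →ₐ[ZMod 2] Polynomial (MvPolynomial σ (ZMod 2)) :=
  aeval fun p => Polynomial.C (X p) + Polynomial.C (X p ^ 2) * Polynomial.X

/-- The Steenrod square `Sq^i` on polynomials. -/
noncomputable def polySq (i : ℕ) :
    MvPolynomial σ (ZMod 2) →ₗ[ZMod 2] MvPolynomial σ (ZMod 2) where
  toFun f := (totalSq f).coeff i
  map_add' f g := by simp
  map_smul' c f := by simp

theorem polySq_apply (i : ℕ) (f : MvPolynomial σ (ZMod 2)) :
    polySq i f = (totalSq f).coeff i := rfl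

theorem totalSq_X (p : σ) : totalSq (X p : MvPolynomial σ (ZMod 2)) =
    Polynomial.C (X p) + Polynomial.C (X p ^ 2) * Polynomial.X := by simp [totalSq]

theorem totalSq_C (c : ZMod 2) : totalSq (C c : MvPolynomial σ (ZMod 2)) =
    Polynomial.C (C c) := by simp [totalSq]

theorem polySq_zero (f : MvPolynomial σ (ZMod 2)) : polySq 0 f = f := by
  have : (Polynomial.constantCoeff.comp (totalSq (σ := σ)).toRingHom) = RingHom.id _ := by
    refine MvPolynomial.ringHom_ext ?_ ?_ <;> intro <;> simp [totalSq_X]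
  simpa [polySq_apply] using congrArg (fun φ => φ f) this

theorem polySq_mul (i : ℕ) (f g : MvPolynomial σ (ZMod 2)) :
    polySq i (f * g) = ∑ x ∈ Finset.HasAntidiagonal.antidiagonal i, polySq x.1 f * polySq x.2 g := by
  simp only [polySq_apply, map_mul, Polynomial.coeff_mul]

theorem IsHomog.polySq {f : MvPolynomial σ (ZMod 2)} {n : ℤ} (hf : IsHomog f n) (i : ℕ) :
    IsHomog (polySq i f) (n + i) := by
  refine IsHomog.induction (T := fun n f => ∀ i : ℕ, IsHomog (TopSquares.polySq i f) (n + i))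
    ?_ ?_ ?_ ?_ ?_ hf i
  · intro n i; rw [map_zero]; exact isWeightedHomogeneous_zero _ _ _
  · intro n f g h h' i; rw [map_add]; exact (h i).add (h' i)
  · intro c i
    rw [polySq_apply, totalSq_C, Polynomial.coeff_C]
    split_ifs with h
    · subst h; simpa using isWeightedHomogeneous_C _ c
    · exact isWeightedHomogeneous_zero _ _ _
  · intro p i
    rw [polySq_apply, totalSq_X, Polynomial.coeff_add, Polynomial.coeff_C,
      Polynomial.coeff_C_mul_X]
    have hX := isWeightedHomogeneous_X (ZMod 2) (fun _ : σ => (1 : ℤ)) p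
    match i with
    | 0 => simpa using hX
    | 1 => simpa [pow_two] using hX.mul hX
    | i + 2 => simpa using isWeightedHomogeneous_zero _ _ _
  · intro m n f g h h' i
    rw [polySq_mul]
    refine IsWeightedHomogeneous.sum _ _ _ fun x hx => ?_
    have := (h x.1).mul (h' x.2)
    rw [Finset.HasAntidiagonal.mem_antidiagonal] at hx
    have e : m + n + (i : ℤ) = (m + x.1) + (n + x.2) := by rw [← hx]; push_cast; ring
    rw [e]
    exact this

/-- Both the degree bound and the top coefficient are multiplicative, and they are additive by
Frobenius, so variables and constants suffice. The case `f = 0` is separate because zero is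
homogeneous of every degree, negative ones included. -/
theorem IsHomog.natDegree_totalSq {f : MvPolynomial σ (ZMod 2)} {n : ℤ} (hf : IsHomog f n) :
    f = 0 ∨ ∃ d : ℕ, n = d ∧ (totalSq f).natDegree ≤ d ∧ (totalSq f).coeff d = f ^ 2 := by
  refine IsHomog.induction (T := fun n f => f = 0 ∨ ∃ d : ℕ, n = d ∧ (totalSq f).natDegree ≤ d ∧
    (totalSq f).coeff d = f ^ 2) ?_ ?_ ?_ ?_ ?_ hf
  · simp
  · rintro n f g (rfl | ⟨d, rfl, h1, h2⟩) (rfl | ⟨d', h, h3, h4⟩)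
    · simp
    · exact Or.inr ⟨d', h, by simpa using h3, by simpa using h4⟩
    · exact Or.inr ⟨d, rfl, by simpa using h1, by simpa using h2⟩
    · obtain rfl : d = d' := by exact_mod_cast h
      refine Or.inr ⟨d, rfl, ?_, ?_⟩
      · rw [map_add]; exact Polynomial.natDegree_add_le_of_degree_le h1 h3
      · rw [map_add, Polynomial.coeff_add, h2, h4, CharTwo.add_sq]
  · intro c
    refine Or.inr ⟨0, rfl, ?_, ?_⟩
    · simp
    · rw [totalSq_C, Polynomial.coeff_C_zero, ← map_pow, ZMod.pow_card c]
  · intro p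
    refine Or.inr ⟨1, rfl, ?_, ?_⟩
    · rw [totalSq_X]; compute_degree
    · rw [totalSq_X, Polynomial.coeff_add, Polynomial.coeff_C_mul_X]; simp
  · rintro m n f g (rfl | ⟨d, rfl, h1, h2⟩) (rfl | ⟨d', rfl, h3, h4⟩)
    · simp
    · simp
    · simp
    · refine Or.inr ⟨d + d', by push_cast; rfl, ?_, ?_⟩
      · rw [map_mul]; exact Polynomial.natDegree_mul_le_of_le h1 h3
      · rw [map_mul, Polynomial.coeff_mul_add_eq_of_natDegree_le h1 h3, h2, h4, mul_pow]

theorem IsHomog.polySq_eq_zero {f : MvPolynomial σ (ZMod 2)} {n : ℤ} (hf : IsHomog f n) {i : ℕ}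
    (hi : n < i) : TopSquares.polySq i f = 0 := by
  obtain rfl | ⟨d, rfl, h, -⟩ := hf.natDegree_totalSq
  · simp
  · exact Polynomial.coeff_eq_zero_of_natDegree_lt (h.trans_lt (by exact_mod_cast hi))

theorem IsHomog.polySq_eq_sq {f : MvPolynomial σ (ZMod 2)} {i : ℕ} (hf : IsHomog f i) :
    TopSquares.polySq i f = f ^ 2 := by
  obtain rfl | ⟨d, h, -, h'⟩ := hf.natDegree_totalSq
  · simp
  · obtain rfl : i = d := by exact_mod_cast h
    exact h'

theorem IsHomog.pderiv {f : MvPolynomial σ (ZMod 2)} {n : ℤ} (hf : IsHomog f n) (p : σ) :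
    IsHomog (pderiv p f) (n - 1) := by
  classical
  refine IsHomog.induction (T := fun n f => IsHomog f n ∧ IsHomog (MvPolynomial.pderiv p f) (n - 1))
    ?_ ?_ ?_ ?_ ?_ hf |>.2
  · intro n; rw [map_zero]
    exact ⟨isWeightedHomogeneous_zero _ _ _, isWeightedHomogeneous_zero _ _ _⟩
  · intro n f g h h'; rw [map_add]; exact ⟨h.1.add h'.1, h.2.add h'.2⟩
  · intro c; rw [pderiv_C]
    exact ⟨isWeightedHomogeneous_C _ _, isWeightedHomogeneous_zero _ _ _⟩
  · intro q
    refine ⟨isWeightedHomogeneous_X _ _ _, ?_⟩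
    rw [pderiv_X]
    by_cases h : p = q
    · subst h; simpa using isWeightedHomogeneous_one _ _
    · rw [Pi.single_eq_of_ne' h]; exact isWeightedHomogeneous_zero _ _ _
  · intro m n f g h h'
    refine ⟨h.1.mul h'.1, ?_⟩
    rw [Derivation.leibniz, smul_eq_mul, smul_eq_mul]
    refine IsWeightedHomogeneous.add ?_ ?_
    · rw [add_sub_assoc]; exact h.1.mul h'.2
    · rw [show m + n - 1 = n + (m - 1) by ring]; exact h'.1.mul h.2

/-- By the Cartan and Leibniz formulas it is enough to check variables, where it holds since x² has
zero derivative in characteristic 2. -/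
theorem polySq_pderiv (i : ℕ) (p : σ) (f : MvPolynomial σ (ZMod 2)) :
    polySq i (pderiv p f) = pderiv p (polySq i f) := by
  classical
  induction f using MvPolynomial.induction_on generalizing i with
  | C c =>
    simp only [pderiv_C, map_zero, polySq_apply, totalSq_C, Polynomial.coeff_C]
    split_ifs <;> simp
  | add f g h h' => simp [h, h']
  | mul_X f q h =>
    have h2 : ∀ j, polySq j (pderiv p (X q)) =
        pderiv p (polySq j (X q : MvPolynomial σ (ZMod 2))) := by
      intro j
      have hsq : pderiv p (X q ^ 2 : MvPolynomial σ (ZMod 2)) = 0 := by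
        rw [pow_two, Derivation.leibniz]; exact CharTwo.add_self_eq_zero _
      have h1 : pderiv p (polySq j (X q : MvPolynomial σ (ZMod 2))) =
          if j = 0 then pderiv p (X q) else 0 := by
        rw [polySq_apply, totalSq_X, Polynomial.coeff_add, Polynomial.coeff_C,
          Polynomial.coeff_C_mul_X]
        split_ifs <;> simp [hsq]
      rw [h1, pderiv_X]
      by_cases hpq : p = q
      · subst hpq
        simp [polySq_apply, Polynomial.coeff_one]
      · rw [Pi.single_eq_of_ne' hpq]; simp
    have hl : ∀ a b : MvPolynomial σ (ZMod 2),
        pderiv p (a * b) = a * pderiv p b + b * pderiv p a := fun a b => by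
      rw [Derivation.leibniz, smul_eq_mul, smul_eq_mul]
    rw [hl, map_add, polySq_mul, polySq_mul, polySq_mul, map_sum]
    simp only [hl, Finset.sum_add_distrib]
    congr 1
    · exact Finset.sum_congr rfl fun x _ => by rw [h2]
    · rw [← Finset.Nat.sum_antidiagonal_swap]
      exact Finset.sum_congr rfl fun x _ => by simp [h]

end PolynomialModel

/-! ### The Adem relations on polynomials, by the Bullett–Macdonald identity and a residue. -/

section AdemModel

open Polynomial

theorem coeff_eval₂_C_mul_X {R S : Type*} [CommRing R] [CommRing S] (g : R →+* S[X]) (β : S)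
    (p : R[X]) (N : ℕ) :
    (p.eval₂ g (C β * X)).coeff N =
      ∑ x ∈ Finset.HasAntidiagonal.antidiagonal N, (g (p.coeff x.2)).coeff x.1 * β ^ x.2 := by
  induction p using Polynomial.induction_on' with
  | add p q hp hq => simp [eval₂_add, hp, hq, add_mul, Finset.sum_add_distrib]
  | monomial b c =>
    rw [eval₂_monomial, mul_pow, ← C_pow, ← mul_assoc, coeff_mul_X_pow', coeff_mul_C]
    split_ifs with h
    · rw [Finset.sum_eq_single (N - b, b)]
      · simp
      · rintro ⟨x, y⟩ hx hne
        rw [Finset.HasAntidiagonal.mem_antidiagonal] at hx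
        have : b ≠ y := by
          rintro rfl
          apply hne
          simp only [Prod.mk.injEq, and_true]
          simp only at hx
          omega
        simp [coeff_monomial, this]
      · intro hx
        exact absurd (Finset.HasAntidiagonal.mem_antidiagonal.2 (by simp only; omega)) hx
    · symm
      refine Finset.sum_eq_zero fun x hx => ?_
      rw [Finset.HasAntidiagonal.mem_antidiagonal] at hx
      have : b ≠ x.2 := by omega
      simp [coeff_monomial, this]

variable {R : Type*} [CommRing R]

/-- The homomorphism `f ↦ ∑ α ^ a * β ^ b * z ^ (a + b) * T_a (T_b f)`, where `T_i f` denotes the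
`i`-th coefficient of `T f`. -/
noncomputable def doubleSq (T : R →+* R[X]) (α β : R[X]) : R →+* R[X][X] :=
  (eval₂RingHom ((eval₂RingHom (C.comp C) (C α * X)).comp T) (C β * X)).comp T

theorem coeff_doubleSq (T : R →+* R[X]) (α β : R[X]) (f : R) (N : ℕ) :
    (doubleSq T α β f).coeff N = ∑ x ∈ Finset.HasAntidiagonal.antidiagonal N,
      C ((T ((T f).coeff x.2)).coeff x.1) * (α ^ x.1 * β ^ x.2) := by
  have h1 : ∀ (g : R) (n : ℕ),
      (eval₂ (C.comp C) (C α * X) (T g)).coeff n = C ((T g).coeff n) * α ^ n := by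
    intro g n
    rw [coeff_eval₂_C_mul_X, Finset.sum_eq_single (0, n)]
    · simp
    · rintro ⟨x, y⟩ hx hne
      rw [Finset.HasAntidiagonal.mem_antidiagonal] at hx
      have : x ≠ 0 := by
        rintro rfl
        apply hne
        simpa using hx
      simp [coeff_C, this]
    · simp
  change (eval₂ ((eval₂RingHom (C.comp C) (C α * X)).comp T) (C β * X) (T f)).coeff N = _
  rw [coeff_eval₂_C_mul_X]
  refine Finset.sum_congr rfl fun x _ => ?_
  change (eval₂ (C.comp C) (C α * X) (T ((T f).coeff x.2))).coeff x.1 * _ = _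
  rw [h1, mul_assoc]

theorem doubleSq_apply_of_eq [CharP R 2] (T : R →+* R[X]) (α β : R[X]) (x : R)
    (hx : T x = C x + C (x ^ 2) * X) : doubleSq T α β x =
      C (C x) + C (C x) ^ 2 * C (α + β) * X + C (C x) ^ 4 * C (α ^ 2 * β) * X ^ 3 := by
  have h2 : (2 : R[X][X]) = 0 := by
    rw [← map_ofNat (C.comp C : R →+* R[X][X]) 2, CharTwo.two_eq_zero, map_zero]
  have : doubleSq T α β x = C (C x) + C (C x) ^ 2 * (C α * X) +
      (C (C x) + C (C x) ^ 2 * (C α * X)) ^ 2 * (C β * X) := by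
    simp only [doubleSq, RingHom.comp_apply, coe_eval₂RingHom, hx, eval₂_C,
      eval₂_X, map_pow, map_add, map_mul]
  rw [this]
  simp only [map_add, map_mul, map_pow]
  linear_combination (C (C x) ^ 3 * C α * C β * X ^ 2) * h2

/-- The value on x depends only on α + β and α²β. With s = `X`, both pairs give 1 + s + s² and s²(1
+ s)². -/
theorem doubleSq_symm_of_eq [CharP R 2] (T : R →+* R[X]) (x : R)
    (hx : T x = C x + C (x ^ 2) * X) :
    doubleSq T (X ^ 2 + X) 1 x = doubleSq T (1 + X) (X ^ 2) x := by
  rw [doubleSq_apply_of_eq _ _ _ _ hx, doubleSq_apply_of_eq _ _ _ _ hx]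
  have h1 : (X ^ 2 + X + 1 : R[X]) = 1 + X + X ^ 2 := by ring
  have h2 : ((X ^ 2 + X) ^ 2 * 1 : R[X]) = (1 + X) ^ 2 * X ^ 2 := by ring
  rw [h1, h2]

theorem one_add_X_eq_one_sub_X [CharP R 2] :
    (1 + PowerSeries.X : PowerSeries R) = 1 - PowerSeries.X := by
  have h2 : (2 : PowerSeries R) = 0 := by
    rw [← map_ofNat (PowerSeries.C (R := R)) 2, CharTwo.two_eq_zero, map_zero]
  linear_combination PowerSeries.X * h2

/-- The coefficient of `s⁻¹` in `p ds / (s (1 + s)) ^ (a + 1)`. -/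
noncomputable def ademResidue (a : ℕ) : R[X] →ₗ[R] R where
  toFun p := PowerSeries.coeff a ((p : PowerSeries R) * (PowerSeries.invOneSubPow R (a + 1)).val)
  map_add' p q := by simp [add_mul]
  map_smul' c p := by simp [Polynomial.smul_eq_C_mul, mul_assoc]

theorem ademResidue_apply (a : ℕ) (p : R[X]) : ademResidue a p = PowerSeries.coeff a
    ((p : PowerSeries R) * (PowerSeries.invOneSubPow R (a + 1)).val) := rfl

theorem ademResidue_C_mul (a : ℕ) (x : R) (p : R[X]) :
    ademResidue a (C x * p) = x * ademResidue a p := by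
  rw [← smul_eq_C_mul, map_smul, smul_eq_mul]

/-- This is the residue of (s(1 + s))^(c - a - 1) ds. For c < a it is the central binomial
coefficient of a - c, which is even; for c > a there is no pole. -/
theorem ademResidue_left [CharP R 2] (a c : ℕ) :
    ademResidue a ((X ^ 2 + X : R[X]) ^ c) = if c = a then 1 else 0 := by
  have h : (((X ^ 2 + X : R[X]) ^ c : R[X]) : PowerSeries R) =
      PowerSeries.X ^ c * (1 - PowerSeries.X) ^ c := by
    rw [← one_add_X_eq_one_sub_X, ← mul_pow]
    push_cast
    congr 1
    ring
  rw [ademResidue_apply, h, mul_assoc, PowerSeries.coeff_X_pow_mul']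
  split_ifs with h1 h2 h2
  · subst h2
    have := PowerSeries.one_sub_pow_mul_invOneSubPow_val_add_eq_invOneSubPow_val R 1 c
    rw [add_comm c 1, this, PowerSeries.invOneSubPow_val_succ_eq_mk_add_choose R 0]
    simp
  · obtain ⟨e, rfl⟩ := Nat.exists_eq_add_of_le h1
    have := PowerSeries.one_sub_pow_mul_invOneSubPow_val_add_eq_invOneSubPow_val R (e + 1) c
    rw [show c + e + 1 = e + 1 + c by ring, this,
      PowerSeries.invOneSubPow_val_succ_eq_mk_add_choose, PowerSeries.coeff_mk,
      Nat.add_sub_cancel_left, ← two_mul]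
    obtain ⟨m, hm⟩ := Nat.two_dvd_centralBinom_of_one_le (show 1 ≤ e by omega)
    rw [Nat.centralBinom] at hm
    rw [hm, Nat.cast_mul]
    simp [CharTwo.two_eq_zero]
  · omega
  · rfl

/-- When a < r the factor (1 + s)^(a + 1) cancels from the denominator, leaving the coefficient of
s^(a - 2j) in the polynomial (1 + s)^(r - a - 1). -/
theorem ademResidue_right [CharP R 2] (a r j : ℕ) (h : 2 * j ≤ a → a < r) :
    ademResidue a ((1 + X : R[X]) ^ r * (X ^ 2) ^ j) =
      if 2 * j ≤ a then ((r - a - 1).choose (a - 2 * j) : R) else 0 := by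
  have h' : (((1 + X : R[X]) ^ r * (X ^ 2) ^ j : R[X]) : PowerSeries R) =
      PowerSeries.X ^ (2 * j) * (1 - PowerSeries.X) ^ r := by
    rw [← one_add_X_eq_one_sub_X, pow_mul, mul_comm]
    push_cast
    rfl
  rw [ademResidue_apply, h', mul_assoc, PowerSeries.coeff_X_pow_mul']
  split_ifs with h1
  · obtain ⟨e, he⟩ := Nat.exists_eq_add_of_lt (h h1)
    have := PowerSeries.one_sub_pow_add_mul_invOneSubPow_val_eq_one_sub_pow R e (a + 1)
    rw [show r = e + (a + 1) by omega, this, ← one_add_X_eq_one_sub_X,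
      show e + (a + 1) - a - 1 = e by omega]
    have hp : ((1 + PowerSeries.X : PowerSeries R) ^ e) = (((1 + X : R[X]) ^ e : R[X]) :
      PowerSeries R) := by push_cast; rfl
    rw [hp, Polynomial.coeff_coe, coeff_one_add_X_pow]
  · rfl

theorem doubleSq_symm {σ : Type} : doubleSq (totalSq (σ := σ)).toRingHom (X ^ 2 + X) 1 =
    doubleSq (totalSq (σ := σ)).toRingHom (1 + X) (X ^ 2) := by
  refine MvPolynomial.ringHom_ext ?_ ?_
  · intro c
    simp [doubleSq]
  · intro p
    exact doubleSq_symm_of_eq _ _ (totalSq_X p)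

/-- Take the coefficient of z^(a + b) on both sides of `doubleSq_symm`, then the residue in s. The
left side collapses to the single term Sq^a Sq^b; on the right the residues are the Adem
coefficients. -/
theorem polySq_adem {σ : Type} (f : MvPolynomial σ (ZMod 2)) (a b : ℕ) (h : a < 2 * b) :
    polySq a (polySq b f) = ∑ t ∈ Finset.range (a / 2 + 1),
      ((b - t - 1).choose (a - 2 * t)) • polySq (a + b - t) (polySq t f) := by
  have key := congrArg (fun φ => ademResidue a ((φ f).coeff (a + b))) (doubleSq_symm (σ := σ))
  simp only [coeff_doubleSq, AlgHom.toRingHom_eq_coe, RingHom.coe_coe, ← polySq_apply, map_sum, ademResidue_C_mul, one_pow, mul_one,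
    ademResidue_left] at key
  rw [Finset.sum_eq_single (a, b)] at key
  · simp only [if_true, mul_one] at key
    rw [key, Finset.Nat.sum_antidiagonal_eq_sum_range_succ_mk, ← Finset.sum_range_reflect]
    have hs : Finset.range (a / 2 + 1) ⊆ Finset.range (a + b + 1) := by
      intro x; simp only [Finset.mem_range]; omega
    rw [← Finset.sum_subset hs]
    · refine Finset.sum_congr rfl fun t ht => ?_
      rw [Finset.mem_range] at ht
      have e1 : a + b + 1 - 1 - t = a + b - t := by omega
      have e2 : a + b - (a + b - t) = t := by omega
      simp only [e1, e2]
      rw [ademResidue_right _ _ _ (by omega), if_pos (by omega),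
        show a + b - t - a - 1 = b - t - 1 by omega, nsmul_eq_mul, mul_comm]
    · intro t ht ht'
      rw [Finset.mem_range] at ht ht'
      have e2 : a + b - (a + b + 1 - 1 - t) = t := by omega
      simp only [e2]
      rw [ademResidue_right _ _ _ (by omega), if_neg (by omega), mul_zero]
  · rintro ⟨x, y⟩ hx hne
    rw [Finset.HasAntidiagonal.mem_antidiagonal] at hx
    have : x ≠ a := by
      rintro rfl
      apply hne
      simp only [Prod.mk.injEq, true_and]
      simp only at hx
      omega
    rw [if_neg this, mul_zero]
  · intro hx
    exact (hx (Finset.HasAntidiagonal.mem_antidiagonal.2 rfl)).elim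

end AdemModel

/-! ### Polynomial rings as representations of `Q`. -/

section Representation

variable (σ : Type)

/-- The homogeneous polynomials over `𝔽₂` of degree `d`. -/
abbrev polyDeg (d : ℤ) : Submodule (ZMod 2) (MvPolynomial σ (ZMod 2)) :=
  MvPolynomial.weightedHomogeneousSubmodule (ZMod 2) (fun _ : σ => (1 : ℤ)) d

/-- The full subcategory of `𝔽₂`-vector spaces on the spaces `polyDeg σ d`. -/
abbrev PolyCat := InducedCategory (ModuleCat.{0} (ZMod 2)) fun d : Degree =>
  ModuleCat.of (ZMod 2) (polyDeg σ d.val)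

variable {σ} in
/-- The linear map underlying a morphism of `PolyCat`. -/
noncomputable def PolyCat.lin {a b : PolyCat σ} :
    (a ⟶ b) →+ (polyDeg σ a.val →ₗ[ZMod 2] polyDeg σ b.val) where
  toFun f := f.hom.hom
  map_zero' := rfl
  map_add' _ _ := rfl

variable {σ} in
theorem PolyCat.lin_comp {a b c : PolyCat σ} (f : a ⟶ b) (g : b ⟶ c) (x : polyDeg σ a.val) :
    PolyCat.lin (f ≫ g) x = PolyCat.lin g (PolyCat.lin f x) := rfl

variable {σ} in
theorem PolyCat.eq_zero {a b : PolyCat σ} (f : a ⟶ b) (h : ∀ x, (PolyCat.lin f x).val = 0) :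
    f = 0 := by
  refine InducedCategory.hom_ext (ModuleCat.hom_ext (LinearMap.ext fun x => Subtype.ext ?_))
  exact h x

/-- The square `a ⟶ b` acting on polynomials. -/
noncomputable def polySqDeg (a b : ℤ) (h : a < b) :
    polyDeg σ a →ₗ[ZMod 2] polyDeg σ b :=
  (polySq (b - a).toNat).restrict fun f hf => by
    have := IsHomog.polySq (f := f) hf (b - a).toNat
    rwa [show a + ((b - a).toNat : ℤ) = b by omega] at this

/-- The action of the generating squares on polynomials. -/
noncomputable def polyPrefunctor : Degree ⥤q PolyCat σ where
  obj d := d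
  map {a b} h := InducedCategory.homMk (ModuleCat.ofHom (polySqDeg σ a.val b.val h.down))

/-- The action of `FreeSquares` on polynomials. -/
noncomputable def freePolyRep : FreeSquares ⥤ PolyCat σ :=
  Free.lift (ZMod 2) (Paths.lift (polyPrefunctor σ))

instance : (freePolyRep σ).Additive := Free.lift_additive _ _

theorem freePolyRep_map_sq {a b : ℤ} (h : a ≤ b) (f : polyDeg σ a) :
    (PolyCat.lin ((freePolyRep σ).map (sq a b)) f).val = polySq (b - a).toNat f.val := by
  unfold sq
  split_ifs with h1 h2
  · have : (freePolyRep σ).map ((Free.embedding (ZMod 2) (Paths Degree)).map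
      ((Paths.of Degree).map (X := Degree.mk a) (Y := Degree.mk b) (PLift.up h1))) =
        (polyPrefunctor σ).map (X := Degree.mk a) (Y := Degree.mk b) (PLift.up h1) := by
      refine (Free.lift_map_single _ _ _ _).trans ?_
      rw [one_smul]
      exact Paths.lift_toPath _ _
    rw [this]
    rfl
  · subst h2
    simp only [eqToHom_refl, CategoryTheory.Functor.map_id, sub_self, Int.toNat_zero, polySq_zero]
    rfl
  · omega

theorem freePolyRep_map_sq_of_lt {a b : ℤ} (h : b < a) : (freePolyRep σ).map (sq a b) = 0 := by
  unfold sq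
  rw [dif_neg (by omega), dif_neg (by omega), Functor.map_zero]

theorem freePolyRep_map_eq_zero {x y : FreeSquares} (f : x ⟶ y)
    (hf : IdealClosure UnstableRelations f) : (freePolyRep σ).map f = 0 := by
  induction hf with
  | of f hf =>
    refine PolyCat.eq_zero _ fun x => ?_
    cases hf with
    | adem n i j hi hij =>
      have hx := polySq_adem (x : MvPolynomial σ (ZMod 2)) i j hij
      have h1 := freePolyRep_map_sq σ (show n ≤ n + j by omega) x
      have h2 := freePolyRep_map_sq σ (show n + j ≤ n + i + j by omega)
        (PolyCat.lin ((freePolyRep σ).map (sq n (n + j))) x)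
      rw [ademRelation, Functor.map_sub, Functor.map_sum, map_sub, map_sum, LinearMap.sub_apply,
        Functor.map_comp, PolyCat.lin_comp, LinearMap.sum_apply, AddSubgroupClass.coe_sub, h2, h1,
        sub_eq_zero, AddSubmonoidClass.coe_finsetSum]
      rw [show (n + j - n : ℤ).toNat = j by omega, show (n + i + j - (n + j) : ℤ).toNat = i by omega,
        hx]
      refine Finset.sum_congr rfl fun t ht => ?_
      rw [Finset.mem_range] at ht
      have h3 := freePolyRep_map_sq σ (show n ≤ n + t by omega) x
      have h4 := freePolyRep_map_sq σ (show n + t ≤ n + i + j by omega)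
        (PolyCat.lin ((freePolyRep σ).map (sq n (n + t))) x)
      rw [Functor.map_nsmul, map_nsmul, LinearMap.smul_apply, Functor.map_comp, PolyCat.lin_comp,
        AddSubmonoidClass.coe_nsmul, h4, h3, show (n + t - n : ℤ).toNat = t by omega,
        show (n + i + j - (n + t) : ℤ).toNat = i + j - t by omega]
    | unstable n i h =>
      -- For negative i the morphism `sq` is zero by definition; otherwise Sq^i vanishes because i
      -- exceeds the degree.
      obtain hi | hi := lt_or_ge i 0
      · rw [freePolyRep_map_sq_of_lt σ (by omega)]; rfl
      · have h0 : n ≤ n + i := by omega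
        have h1 : n < ((n + i - n).toNat : ℤ) := by omega
        exact (freePolyRep_map_sq σ h0 x).trans (IsHomog.polySq_eq_zero x.2 h1)
  | zero x y => exact Functor.map_zero _ _ _
  | add f g _ _ hf hg => rw [Functor.map_add, hf, hg, add_zero]
  | neg f _ hf => rw [Functor.map_neg, hf, neg_zero]
  | comp_left f g _ hg => rw [Functor.map_comp, hg, comp_zero]
  | comp_right f g _ hf => rw [Functor.map_comp, hf, zero_comp]

/-- The polynomial ring on `σ` as an unstable module. -/
noncomputable def polyRep : Q ⥤ PolyCat σ :=
  CategoryTheory.Quotient.lift _ (freePolyRep σ) fun x y f g h => by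
    have := freePolyRep_map_eq_zero σ _ h
    rwa [Functor.map_sub, sub_eq_zero] at this

instance : (polyRep σ).Additive where
  map_add {x y f g} := by
    obtain ⟨f, rfl⟩ := Quot.exists_rep f
    obtain ⟨g, rfl⟩ := Quot.exists_rep g
    exact (freePolyRep σ).map_add (f := f) (g := g)

theorem polyRep_map_qSq {a b : ℤ} (h : a ≤ b) (f : polyDeg σ a) :
    (PolyCat.lin ((polyRep σ).map (qSq a b)) f).val = polySq (b - a).toNat f.val :=
  freePolyRep_map_sq σ h f

end Representation

/-! ### The lower-index filtration, regularity, and short exact sequences. -/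

section Systems

variable {G : ℤ → Type*} [∀ n, AddCommGroup (G n)] (s : ∀ a b, G a →+ G b)

/-- The elements of degree `d` generated by the images of the degree-raising squares `a ⟶ d` whose
lower index `2 * a - d` is less than `i`. -/
def filt (i d : ℤ) : AddSubgroup (G d) :=
  AddSubgroup.closure {y | ∃ a, a < d ∧ 2 * a - d < i ∧ ∃ x : G a, s a d x = y}

variable {s} in
theorem sq_mem_filt {i a d : ℤ} (h : a < d) (h' : 2 * a - d < i) (x : G a) :
    s a d x ∈ filt s i d :=
  AddSubgroup.subset_closure ⟨a, h, h', x, rfl⟩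

theorem filt_mono {i j : ℤ} (h : i ≤ j) (d : ℤ) : filt s i d ≤ filt s j d :=
  AddSubgroup.closure_mono fun _ ⟨a, h1, h2, x, hx⟩ => ⟨a, h1, h2.trans_le h, x, hx⟩

/-- A source `a < d` has lower index `2 * a - d ≤ d - 2`, so no generators appear beyond `d - 1`. -/
theorem filt_eq_of_le {i j d : ℤ} (hi : d - 1 ≤ i) (h : i ≤ j) : filt s j d = filt s i d := by
  refine le_antisymm (AddSubgroup.closure_mono ?_) (filt_mono s h d)
  rintro _ ⟨a, h1, h2, x, hx⟩
  exact ⟨a, h1, by omega, x, hx⟩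

/-- The squares of negative lower index vanish, and squares map `filt s j` to itself whenever they
have lower index `j < k`, as the Adem relations imply. -/
structure IsUnstableSystem (k : ℤ) : Prop where
  eq_zero : ∀ a b, 2 * a - b < 0 → ∀ x, s a b x = 0
  adem : ∀ a b c, a < b → b < c → 2 * a - b < 2 * b - c → 2 * b - c < k → ∀ x,
    s b c (s a b x) ∈ filt s (2 * b - c) c

/-- The squares of lower index `j < i` act injectively modulo those of lower index less
than `j`. -/
def IsRegularSystem (i : ℤ) : Prop :=
  ∀ a b, a < b → 0 ≤ 2 * a - b → 2 * a - b < i → ∀ x, s a b x ∈ filt s (2 * a - b) b →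
    x ∈ filt s (2 * a - b) a

variable {s}

theorem IsUnstableSystem.filt_zero {k : ℤ} (hs : IsUnstableSystem s k) (d : ℤ) :
    filt s 0 d = ⊥ := by
  rw [filt, AddSubgroup.closure_eq_bot_iff]
  rintro _ ⟨a, h1, h2, x, rfl⟩
  exact hs.eq_zero _ _ h2 _

theorem IsUnstableSystem.sq_mem {k : ℤ} (hs : IsUnstableSystem s k) {a b : ℤ} (hab : a < b)
    (hk : 2 * a - b < k) {x : G a} (hx : x ∈ filt s (2 * a - b) a) :
    s a b x ∈ filt s (2 * a - b) b := by
  induction hx using AddSubgroup.closure_induction with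
  | mem x hx =>
    obtain ⟨c, h1, h2, y, rfl⟩ := hx
    exact hs.adem _ _ _ h1 hab h2 hk y
  | zero => rw [map_zero]; exact zero_mem _
  | add x y _ _ hx hy => rw [map_add]; exact add_mem hx hy
  | neg x _ hx => rw [map_neg]; exact neg_mem hx

/-- The target d and the lower index j determine the source, so consecutive filtration steps differ
by the image of at most one square. -/
theorem exists_of_mem_filt_add_one {j d : ℤ} {x : G d} (hx : x ∈ filt s (j + 1) d) :
    x ∈ filt s j d ∨ ∃ a, a < d ∧ 2 * a - d = j ∧ ∃ y : G a, x - s a d y ∈ filt s j d := by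
  by_cases h : ∃ a, a < d ∧ 2 * a - d = j
  · obtain ⟨a, h1, h2⟩ := h
    refine Or.inr ⟨a, h1, h2, ?_⟩
    induction hx using AddSubgroup.closure_induction with
    | mem x hx =>
      obtain ⟨c, h3, h4, y, rfl⟩ := hx
      obtain h5 | h5 := lt_or_eq_of_le (Int.lt_add_one_iff.1 h4)
      · exact ⟨0, by rw [map_zero, sub_zero]; exact sq_mem_filt h3 h5 y⟩
      · obtain rfl : c = a := by omega
        exact ⟨y, by rw [sub_self]; exact zero_mem _⟩
    | zero => exact ⟨0, by rw [map_zero, sub_zero]; exact zero_mem _⟩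
    | add x x' _ _ hx hx' =>
      obtain ⟨y, hy⟩ := hx
      obtain ⟨y', hy'⟩ := hx'
      refine ⟨y + y', ?_⟩
      rw [map_add, add_sub_add_comm]
      exact add_mem hy hy'
    | neg x _ hx =>
      obtain ⟨y, hy⟩ := hx
      refine ⟨-y, ?_⟩
      rw [map_neg, ← neg_sub']
      exact neg_mem hy
  · left
    refine AddSubgroup.closure_mono ?_ hx
    rintro _ ⟨a, h1, h2, y, hy⟩
    exact ⟨a, h1, lt_of_le_of_ne (Int.lt_add_one_iff.1 h2) fun h3 => h ⟨a, h1, h3⟩, y, hy⟩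

section Maps

variable {A B C : ℤ → Type*} [∀ n, AddCommGroup (A n)] [∀ n, AddCommGroup (B n)]
  [∀ n, AddCommGroup (C n)] {sA : ∀ a b, A a →+ A b} {sB : ∀ a b, B a →+ B b}
  {sC : ∀ a b, C a →+ C b}

theorem map_mem_filt (f : ∀ n, A n →+ B n) (hf : ∀ a b x, f b (sA a b x) = sB a b (f a x))
    {i d : ℤ} {x : A d} (hx : x ∈ filt sA i d) : f d x ∈ filt sB i d := by
  induction hx using AddSubgroup.closure_induction with
  | mem x hx =>
    obtain ⟨c, h1, h2, y, rfl⟩ := hx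
    rw [hf]
    exact sq_mem_filt h1 h2 _
  | zero => rw [map_zero]; exact zero_mem _
  | add x y _ _ hx hy => rw [map_add]; exact add_mem hx hy
  | neg x _ hx => rw [map_neg]; exact neg_mem hx

theorem exists_lift_mem_filt (p : ∀ n, B n →+ C n)
    (hp : ∀ a b x, p b (sB a b x) = sC a b (p a x)) (hsurj : ∀ n, Function.Surjective (p n))
    {i d : ℤ} {x : C d} (hx : x ∈ filt sC i d) : ∃ y ∈ filt sB i d, p d y = x := by
  induction hx using AddSubgroup.closure_induction with
  | mem x hx =>
    obtain ⟨c, h1, h2, y, rfl⟩ := hx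
    obtain ⟨z, rfl⟩ := hsurj c y
    exact ⟨_, sq_mem_filt h1 h2 z, hp _ _ _⟩
  | zero => exact ⟨0, zero_mem _, map_zero _⟩
  | add x y _ _ hx hy =>
    obtain ⟨x, hx, rfl⟩ := hx
    obtain ⟨y, hy, rfl⟩ := hy
    exact ⟨x + y, add_mem hx hy, map_add _ _ _⟩
  | neg x _ hx =>
    obtain ⟨x, hx, rfl⟩ := hx
    exact ⟨-x, neg_mem hx, map_neg _ _⟩

variable (f : ∀ n, A n →+ B n) (hf : ∀ a b x, f b (sA a b x) = sB a b (f a x))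
  (hinj : ∀ n, Function.Injective (f n)) (p : ∀ n, B n →+ C n)
  (hp : ∀ a b x, p b (sB a b x) = sC a b (p a x)) (hsurj : ∀ n, Function.Surjective (p n))
  (hexact : ∀ n x, p n x = 0 ↔ ∃ y, f n y = x)

include hf hinj hp hsurj hexact

/-- In a short exact sequence with regular quotient, the filtration of the subobject is induced. -/
theorem mem_filt_of_map_mem_filt {k : ℤ} {l : ℕ} (hB : IsUnstableSystem sB k) (hlk : l ≤ k)
    (hC : IsRegularSystem sC l) {d : ℤ} {x : A d} (hx : f d x ∈ filt sB l d) :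
    x ∈ filt sA l d := by
  induction l generalizing d with
  | zero =>
    have h0 : f d x ∈ filt sB 0 d := hx
    rw [hB.filt_zero, AddSubgroup.mem_bot] at h0
    rw [(hinj d) (h0.trans (map_zero _).symm)]
    exact zero_mem _
  | succ l ih =>
    push_cast at hlk hC hx ⊢
    have ih' : ∀ {d : ℤ} {x : A d}, f d x ∈ filt sB l d → x ∈ filt sA l d := fun hx =>
      ih (by omega) (fun a b h1 h2 h3 => hC a b h1 h2 (by omega)) hx
    obtain h | ⟨a, h1, h2, y, hy⟩ := exists_of_mem_filt_add_one hx
    · exact filt_mono _ (by omega) _ (ih' h)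
    -- Modulo `filt sB l`, `f d x` is the square of y. Its image in C is zero, so regularity of C
    -- places `p a y` in the filtration.
    · have h3 : sC a d (p a y) ∈ filt sC l d := by
        have h4 := map_mem_filt p hp hy
        rw [map_sub, hp, (hexact d _).2 ⟨x, rfl⟩, zero_sub] at h4
        simpa using neg_mem h4
      rw [← h2] at h3
      obtain ⟨z, hz, hzy⟩ := exists_lift_mem_filt p hp hsurj
        (hC a d h1 (by omega) (by omega) _ h3)
      obtain ⟨t, ht⟩ := (hexact a (y - z)).1 (by rw [map_sub, hzy, sub_self])
      -- Here y = z + f t with z in the filtration. Since the square preserves the filtration,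
      -- subtracting the square of t from x lowers the filtration index and induction applies.
      have h5 : f d (x - sA a d t) ∈ filt sB l d := by
        have h6 := hB.sq_mem h1 (by omega) hz
        rw [h2] at h6
        rw [map_sub, hf, ht, map_sub, ← sub_add]
        exact add_mem hy h6
      have h7 : sA a d t ∈ filt sA (l + 1) d := sq_mem_filt h1 (by omega) t
      simpa using add_mem (filt_mono sA (show (l : ℤ) ≤ l + 1 by omega) d (ih' h5)) h7

/-- In a short exact sequence the subobject is more regular than the quotient. -/
theorem IsRegularSystem.of_shortExact {k : ℤ} {l : ℕ} (hB : IsUnstableSystem sB k) (hlk : l < k)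
    (hBr : IsRegularSystem sB k) (hC : IsRegularSystem sC l) :
    IsRegularSystem sA (l + 1 : ℕ) := by
  intro a b h1 h2 h3 x hx
  push_cast at h3
  -- Regularity of B applies to the image of x. The conclusion returns to A because lower indices
  -- are at most l, where the filtration of A is the induced one.
  have h4 : f a x ∈ filt sB (2 * a - b) a := by
    refine hBr a b h1 h2 (by omega) _ ?_
    rw [← hf]
    exact map_mem_filt f hf hx
  obtain ⟨m, hm⟩ := Int.eq_ofNat_of_zero_le h2
  rw [hm] at h4 ⊢
  exact mem_filt_of_map_mem_filt f hf hinj p hp hsurj hexact hB (by omega)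
    (fun a b h1 h2 h3 => hC a b h1 h2 (by omega)) h4

end Maps

end Systems

/-! ### Squares and Adem relations inside `Qk k`. -/

section Squares

theorem sq_self (a : ℤ) : sq a a = 𝟙 _ := by
  rw [sq, dif_neg (lt_irrefl a), dif_pos rfl, eqToHom_refl]

theorem qSq_self (a : ℤ) : qSq a a = 𝟙 _ := by
  rw [qSq, sq_self, CategoryTheory.Functor.map_id]

theorem functor_map_eq_zero {x y : FreeSquares} (f : x ⟶ y) (hf : UnstableRelations f) :
    (Quotient.functor (idealRel UnstableRelations)).map f = 0 := by
  refine (Quotient.functor_map_eq_iff _ f 0).2 ?_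
  change IdealClosure _ (f - 0)
  rw [sub_zero]
  exact IdealClosure.of f hf

instance : (Quotient.functor (idealRel UnstableRelations)).Additive where
  map_add := rfl

theorem qSq_eq_zero {a b : ℤ} (h : 2 * a - b < 0) : qSq a b = 0 := by
  obtain ⟨i, rfl⟩ : ∃ i, b = a + i := ⟨b - a, by ring⟩
  exact functor_map_eq_zero _ (UnstableRelations.unstable a i (by omega))

/-- In terms of lower indices, the Adem condition i < 2j says that the square applied first has the
smaller one. -/
theorem qSq_comp_qSq {a b c : ℤ} (hbc : b < c) (h : 2 * a - b < 2 * b - c) :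
    qSq a b ≫ qSq b c = ∑ t ∈ Finset.range ((c - b).toNat / 2 + 1),
      (((b - a).toNat - t - 1).choose ((c - b).toNat - 2 * t)) •
        (qSq a (a + t) ≫ qSq (a + t) c) := by
  obtain ⟨j, rfl⟩ : ∃ j : ℕ, b = a + j := ⟨(b - a).toNat, by omega⟩
  obtain ⟨i, rfl⟩ : ∃ i : ℕ, c = a + i + j := ⟨(c - (a + j)).toNat, by omega⟩
  rw [show (a + i + j - (a + j)).toNat = i by omega, show (a + j - a).toNat = j by omega]
  have := functor_map_eq_zero _ (UnstableRelations.adem a i j (by omega) (by omega))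
  rw [ademRelation, Functor.map_sub, sub_eq_zero, Functor.map_sum, Functor.map_comp] at this
  refine this.trans (Finset.sum_congr rfl fun t _ => ?_)
  rw [Functor.map_nsmul, Functor.map_comp]
  rfl

variable (k : ℕ)

/-- The integer `n` as an object of `Qk k`. -/
noncomputable abbrev objQk (n : ℤ) : Qk k :=
  ⟨(Quotient.functor (idealRel UnstableRelations)).obj (FreeSquares.deg n)⟩

variable {k} in
/-- The inclusion of the morphisms of `Qk k` in those of `Q`. -/
noncomputable def homQ {x y : Qk k} : (x ⟶ y) →+ (x.obj ⟶ y.obj) where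
  toFun f := f.hom
  map_zero' := rfl
  map_add' _ _ := rfl

variable {k} in
theorem homQ_injective {x y : Qk k} : Function.Injective (homQ (x := x) (y := y)) :=
  fun _ _ h => WideSubcategory.hom_ext _ h

variable {k} in
theorem homQ_comp {x y z : Qk k} (f : x ⟶ y) (g : y ⟶ z) : homQ (f ≫ g) = homQ f ≫ homQ g := rfl

open Classical in
/-- The square `a ⟶ b` as a morphism of `Qk k`, when its lower index is less than `k`. -/
noncomputable def topSq (a b : ℤ) : objQk k a ⟶ objQk k b :=
  if h : a ≤ b ∧ 2 * a - b < k then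
    ⟨qSq a b, by
      obtain ⟨i, rfl⟩ : ∃ i, b = a + i := ⟨b - a, by ring⟩
      exact SubringoidClosure.of _ (TopSquare.mk a i (by omega) (by omega))⟩
  else 0

variable {k}

theorem homQ_topSq {a b : ℤ} (h : a ≤ b) (h' : 2 * a - b < k) : homQ (topSq k a b) = qSq a b := by
  rw [topSq, dif_pos ⟨h, h'⟩]
  rfl

theorem topSq_eq_zero {a b : ℤ} (h : 2 * a - b < 0) : topSq k a b = 0 := by
  by_cases h' : a ≤ b
  · apply homQ_injective
    rw [homQ_topSq h' (by omega), qSq_eq_zero h, map_zero]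
  · rw [topSq, dif_neg (by tauto)]

theorem topSq_self {a : ℤ} (h : a < k) : topSq k a a = 𝟙 _ := by
  apply homQ_injective
  rw [homQ_topSq le_rfl (by omega), qSq_self]
  rfl

theorem id_eq_zero {a : ℤ} (h : a < 0) : 𝟙 (objQk k a) = 0 := by
  rw [← topSq_self (by omega), topSq_eq_zero (by omega)]

theorem topSq_comp_topSq {a b c : ℤ} (hab : a < b) (hbc : b < c) (h : 2 * a - b < 2 * b - c)
    (hk : 2 * b - c < k) :
    topSq k a b ≫ topSq k b c = ∑ t ∈ Finset.range ((c - b).toNat / 2 + 1),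
      (((b - a).toNat - t - 1).choose ((c - b).toNat - 2 * t)) •
        (topSq k a (a + t) ≫ topSq k (a + t) c) := by
  apply homQ_injective
  rw [homQ_comp, homQ_topSq hab.le (by omega), homQ_topSq hbc.le hk, qSq_comp_qSq hbc h, map_sum]
  refine Finset.sum_congr rfl fun t ht => ?_
  rw [Finset.mem_range] at ht
  rw [map_nsmul, homQ_comp]
  -- A nonzero binomial coefficient forces the inner square Sq^t to have lower index below `2 * b -
  -- c < k`, so the relation already lives in `Qk k`. For the remaining t the default value of
  -- `topSq` is irrelevant.
  by_cases h0 : (b - a).toNat - t - 1 < (c - b).toNat - 2 * t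
  · rw [Nat.choose_eq_zero_of_lt h0, zero_smul, zero_smul]
  · rw [homQ_topSq (by omega) (by omega), homQ_topSq (by omega) (by omega)]

theorem add_self_eq_zero {x y : Qk k} (f : x ⟶ y) : f + f = 0 := by
  apply homQ_injective
  rw [map_add, map_zero]
  obtain ⟨g, hg⟩ := (Quotient.functor (idealRel UnstableRelations)).map_surjective (homQ f)
  rw [← hg]
  refine ((Quotient.functor (idealRel UnstableRelations)).map_add (f := g) (g := g)).symm.trans ?_
  rw [← two_nsmul, ← Nat.cast_smul_eq_nsmul (ZMod 2) 2 g, show ((2 : ℕ) : ZMod 2) = 0 from rfl,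
    zero_smul, Functor.map_zero]

/-- In an Adem relation t ≤ i/2 < j, so each outer square on the right starts in degree a + t < b
and has smaller lower index than the original outer square. -/
theorem isUnstableSystem_of_action {G : ℤ → Type*} [∀ n, AddCommGroup (G n)]
    (act : ∀ a b, (objQk k a ⟶ objQk k b) →+ (G a →+ G b))
    (hact : ∀ a b c f g x, act a c (f ≫ g) x = act b c g (act a b f x)) :
    IsUnstableSystem (fun a b => act a b (topSq k a b)) k where
  eq_zero a b h x := by
    rw [topSq_eq_zero h, map_zero, AddMonoidHom.zero_apply]
  adem a b c hab hbc h hk x := by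
    rw [← hact, topSq_comp_topSq hab hbc h hk, map_sum, AddMonoidHom.finsetSum_apply]
    refine sum_mem fun t ht => ?_
    rw [Finset.mem_range] at ht
    rw [map_nsmul, AddMonoidHom.nsmul_apply, hact]
    refine AddSubgroup.nsmul_mem _ ?_ _
    exact sq_mem_filt (s := fun a b => act a b (topSq k a b)) (by omega) (by omega) _

end Squares

/-! ### Morphism groups of `Qk k`. -/

section Homs

variable (k : ℕ) (n : ℤ)

/-- The action of morphisms of `Qk k` on the morphisms with source `n`. -/
noncomputable def homAct (a b : ℤ) :
    (objQk k a ⟶ objQk k b) →+ ((objQk k n ⟶ objQk k a) →+ (objQk k n ⟶ objQk k b)) where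
  toFun g := Preadditive.rightComp _ g
  map_zero' := by ext f; exact comp_zero
  map_add' g g' := by ext f; exact Preadditive.comp_add _ _ _ _ _ _

/-- The squares acting on the morphisms with source `n`. -/
noncomputable def homSq (a b : ℤ) : (objQk k n ⟶ objQk k a) →+ (objQk k n ⟶ objQk k b) :=
  homAct k n a b (topSq k a b)

theorem homSq_apply (a b : ℤ) (f : objQk k n ⟶ objQk k a) :
    homSq k n a b f = f ≫ topSq k a b := rfl

theorem homSq_isUnstableSystem : IsUnstableSystem (homSq k n) k :=
  isUnstableSystem_of_action (homAct k n) fun _ _ _ f g x => (Category.assoc x f g).symm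

variable {k n}

/-- A product of top squares is an identity or ends in a degree-raising top square. This makes
inductions on the target degree possible. -/
theorem hom_mem_closure {d : ℤ} (f : objQk k n ⟶ objQk k d) :
    f ∈ AddSubgroup.closure {g | ∃ h : n = d, g = eqToHom (congrArg (objQk k) h)} ⊔
      filt (homSq k n) k d := by
  let T (a b : ℤ) : AddSubgroup (objQk k a ⟶ objQk k b) :=
    AddSubgroup.closure {g | ∃ h : a = b, g = eqToHom (congrArg (objQk k) h)} ⊔
      filt (homSq k a) k b
  have hid : ∀ a, 𝟙 _ ∈ T a a := fun a =>
    AddSubgroup.mem_sup_left (AddSubgroup.subset_closure ⟨rfl, rfl⟩)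
  let dg (x : Q) : ℤ := (show Degree from x.as).val
  suffices H : ∀ (x y : Q) (f : x ⟶ y) (hf : SubringoidClosure (TopSquare k) f),
      (show objQk k (dg x) ⟶ objQk k (dg y) from ⟨f, hf⟩) ∈ T (dg x) (dg y) from H _ _ f.1 f.2
  intro x y f hf
  induction hf with
  | of f hf =>
    obtain ⟨n, i, hi, h⟩ := hf
    have h1 : ∀ m, n ≤ m → 2 * n - m < k → topSq k n m ∈ T n m := by
      intro m hm hk
      obtain rfl | hm := hm.eq_or_lt
      · rw [topSq_self (by omega)]
        exact hid _
      · refine AddSubgroup.mem_sup_right ?_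
        have := sq_mem_filt (s := homSq k n) hm hk (𝟙 _)
        rwa [homSq_apply, Category.id_comp] at this
    have h2 := h1 (n + i) (by omega) (by omega)
    rw [topSq, dif_pos ⟨by omega, by omega⟩] at h2
    exact h2
  | zero x y => exact zero_mem _
  | add f g hf hg hf' hg' => exact add_mem hf' hg'
  | neg f _ hf => exact neg_mem hf
  | id x => exact hid _
  | @comp x y z f g hf hg hf' hg' =>
    have key : ∀ (a b c : ℤ) (f : objQk k a ⟶ objQk k b), f ∈ T a b →
        T b c ≤ (T a c).comap (Preadditive.leftComp _ f) := by
      intro a b c f hf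
      refine sup_le ((AddSubgroup.closure_le _).2 ?_) ((AddSubgroup.closure_le _).2 ?_)
      · rintro _ ⟨rfl, rfl⟩
        change f ≫ _ ∈ T _ _
        rwa [eqToHom_refl, Category.comp_id]
      · rintro _ ⟨a, h1, h2, g, rfl⟩
        change f ≫ _ ∈ T _ _
        refine AddSubgroup.mem_sup_right ?_
        rw [homSq_apply, ← Category.assoc, ← homSq_apply]
        exact sq_mem_filt h1 h2 _
    exact key _ _ _ _ hf' hg'

theorem hom_eq_zero_of_neg {d : ℤ} (hd : d < 0) (f : objQk k n ⟶ objQk k d) : f = 0 := by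
  rw [← Category.comp_id f, id_eq_zero hd, comp_zero]

theorem hom_mem_filt {d : ℤ} (hd : n ≠ d) (f : objQk k n ⟶ objQk k d) :
    f ∈ filt (homSq k n) k d := by
  have h := hom_mem_closure f
  have he : {g : objQk k n ⟶ objQk k d | ∃ h : n = d, g = eqToHom (congrArg (objQk k) h)} = ∅ := by
    ext g
    simp [hd]
  rwa [he, AddSubgroup.closure_empty, bot_sup_eq] at h

theorem hom_eq_zero_of_lt {d : ℤ} (hd : d < n) (f : objQk k n ⟶ objQk k d) : f = 0 := by
  obtain ⟨m, hm⟩ : ∃ m : ℕ, d < m := ⟨(d + 1).toNat, by omega⟩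
  induction m generalizing d with
  | zero => exact hom_eq_zero_of_neg hm f
  | succ m ih =>
    have h : filt (homSq k n) k d ≤ ⊥ := by
      rw [filt, AddSubgroup.closure_le]
      rintro _ ⟨a, h1, -, x, rfl⟩
      rw [ih (by omega) x (by push_cast at hm; omega), map_zero]
      exact zero_mem _
    exact h (hom_mem_filt hd.ne' f)

theorem end_eq_zero_or_id (f : objQk k n ⟶ objQk k n) : f = 0 ∨ f = 𝟙 _ := by
  have h := hom_mem_closure f
  have h' : filt (homSq k n) k n = ⊥ := by
    rw [filt, AddSubgroup.closure_eq_bot_iff]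
    rintro _ ⟨a, h1, -, x, rfl⟩
    rw [hom_eq_zero_of_lt h1 x, map_zero]
    rfl
  rw [h', sup_bot_eq] at h
  induction h using AddSubgroup.closure_induction with
  | mem x hx => obtain ⟨h, rfl⟩ := hx; exact Or.inr (eqToHom_refl _ _)
  | zero => exact Or.inl rfl
  | add x y _ _ hx hy =>
    obtain rfl | rfl := hx
    · rwa [zero_add]
    · obtain rfl | rfl := hy
      · rw [add_zero]; exact Or.inr rfl
      · exact Or.inl (add_self_eq_zero _)
  | neg x _ hx =>
    rwa [show -x = x from neg_eq_of_add_eq_zero_left (add_self_eq_zero x)]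

end Homs

/-! ### Regularity of the representable modules, by partial derivatives. -/

section Regularity

open MvPolynomial

/-- All iterated partial derivatives of order `j` of the polynomial `f` vanish. -/
def DerivsVanish {σ : Type} : ℕ → MvPolynomial σ (ZMod 2) → Prop
  | 0, f => f = 0
  | j + 1, f => ∀ p, DerivsVanish j (pderiv p f)

variable {σ : Type}

theorem DerivsVanish.zero (j : ℕ) : DerivsVanish j (0 : MvPolynomial σ (ZMod 2)) := by
  induction j with
  | zero => rfl
  | succ j ih => intro p; rwa [map_zero]

theorem DerivsVanish.add {j : ℕ} {f g : MvPolynomial σ (ZMod 2)} (hf : DerivsVanish j f)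
    (hg : DerivsVanish j g) : DerivsVanish j (f + g) := by
  induction j generalizing f g with
  | zero => exact (congrArg₂ (· + ·) hf hg).trans (add_zero 0)
  | succ j ih => intro p; rw [map_add]; exact ih (hf p) (hg p)

theorem DerivsVanish.neg {j : ℕ} {f : MvPolynomial σ (ZMod 2)} (hf : DerivsVanish j f) :
    DerivsVanish j (-f) := by
  induction j generalizing f with
  | zero => exact (congrArg (- ·) hf).trans neg_zero
  | succ j ih => intro p; rw [map_neg]; exact ih (hf p)

theorem DerivsVanish.mono {i j : ℕ} (h : i ≤ j) {f : MvPolynomial σ (ZMod 2)}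
    (hf : DerivsVanish i f) : DerivsVanish j f := by
  induction j generalizing i f with
  | zero => obtain rfl : i = 0 := by omega
            exact hf
  | succ j ih =>
    intro p
    match i with
    | 0 => rw [show f = 0 from hf, map_zero]; exact .zero j
    | i + 1 => exact ih (by omega) (hf p)

/-- Derivatives move inside the square; after j of them the degree is below i and instability
applies. -/
theorem derivsVanish_polySq {j i : ℕ} {m : ℤ} (h : m - j < i) {f : MvPolynomial σ (ZMod 2)}
    (hf : IsHomog f m) : DerivsVanish j (polySq i f) := by
  induction j generalizing f m with
  | zero => exact hf.polySq_eq_zero (by simpa using h)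
  | succ j ih =>
    intro p
    rw [← polySq_pderiv]
    exact ih (by push_cast at h; omega) (hf.pderiv p)

/-- After j derivatives the degree is exactly i, where Sq^i is squaring, which is injective on a
reduced ring. -/
theorem DerivsVanish.of_polySq {j i : ℕ} {m : ℤ} (h : m - j = i) {f : MvPolynomial σ (ZMod 2)}
    (hf : IsHomog f m) (h' : DerivsVanish j (polySq i f)) : DerivsVanish j f := by
  induction j generalizing f m with
  | zero =>
    obtain rfl : m = i := by simpa using h
    have h2 : f ^ 2 = 0 := hf.polySq_eq_sq.symm.trans h'
    exact pow_eq_zero_iff (two_ne_zero) |>.1 h2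
  | succ j ih =>
    intro p
    refine ih (by push_cast at h; omega) (hf.pderiv p) ?_
    rw [polySq_pderiv]
    exact h' p

theorem pderiv_prod_X_of_notMem {p : σ} {s : Finset σ} (hp : p ∉ s) :
    pderiv p (∏ q ∈ s, X q : MvPolynomial σ (ZMod 2)) = 0 := by
  classical
  induction s using Finset.induction_on with
  | empty => rw [Finset.prod_empty, pderiv_one]
  | insert q s hq ih =>
    rw [Finset.mem_insert, not_or] at hp
    rw [Finset.prod_insert hq, Derivation.leibniz, ih hp.2, pderiv_X_of_ne (Ne.symm hp.1),
      smul_zero, smul_zero, add_zero]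

theorem not_derivsVanish_prod_X (s : Finset σ) :
    ¬ DerivsVanish s.card (∏ q ∈ s, X q : MvPolynomial σ (ZMod 2)) := by
  classical
  induction s using Finset.induction_on with
  | empty => rw [Finset.prod_empty]; exact one_ne_zero
  | insert q s hq ih =>
    rw [Finset.card_insert_of_notMem hq]
    intro h
    have := h q
    rw [Finset.prod_insert hq, Derivation.leibniz, pderiv_prod_X_of_notMem hq, pderiv_X_self,
      smul_zero, zero_add, smul_eq_mul, mul_one] at this
    exact ih this

variable (N : ℕ)

/-- The product of all variables, as a homogeneous polynomial. -/
noncomputable def fundamentalClass : polyDeg (Fin N) N :=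
  ⟨∏ p, X p, by
    have : ∀ s : Finset (Fin N),
        IsHomog (∏ p ∈ s, X p : MvPolynomial (Fin N) (ZMod 2)) s.card := by
      intro s
      induction s using Finset.induction_on with
      | empty => simpa using isWeightedHomogeneous_one _ _
      | insert q s hq ih =>
        rw [Finset.prod_insert hq, Finset.card_insert_of_notMem hq, Nat.cast_add, add_comm]
        simpa using (isWeightedHomogeneous_X _ _ q).mul ih
    simpa using this Finset.univ⟩

variable (k : ℕ)

/-- Evaluation of morphisms of `Qk k` on the product of all variables. -/
noncomputable def evalFundamental (d : ℤ) :
    (objQk k N ⟶ objQk k d) →+ MvPolynomial (Fin N) (ZMod 2) where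
  toFun f := (PolyCat.lin ((polyRep (Fin N)).map (homQ f)) (fundamentalClass N)).val
  map_zero' := by rw [map_zero, Functor.map_zero, map_zero]; rfl
  map_add' f g := by rw [map_add, Functor.map_add, map_add]; rfl

variable {N k}

theorem evalFundamental_isHomog {d : ℤ} (f : objQk k N ⟶ objQk k d) :
    IsHomog (evalFundamental N k d f) d :=
  (PolyCat.lin ((polyRep (Fin N)).map (homQ f)) (fundamentalClass N)).2

theorem evalFundamental_id : evalFundamental N k N (𝟙 _) = ∏ p, X p := by
  have : (polyRep (Fin N)).map (homQ (𝟙 (objQk k N))) = 𝟙 _ := CategoryTheory.Functor.map_id _ _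
  change (PolyCat.lin ((polyRep (Fin N)).map (homQ (𝟙 (objQk k N)))) _).val = _
  rw [this]
  rfl

theorem evalFundamental_homSq {a d : ℤ} (h : a ≤ d) (h' : 2 * a - d < k)
    (f : objQk k N ⟶ objQk k a) : evalFundamental N k d (homSq k N a d f) =
      polySq (d - a).toNat (evalFundamental N k a f) := by
  change (PolyCat.lin ((polyRep (Fin N)).map (homQ (f ≫ topSq k a d))) _).val = _
  rw [homQ_comp, homQ_topSq h h', Functor.map_comp]
  exact polyRep_map_qSq (Fin N) h _

theorem derivsVanish_evalFundamental {j : ℕ} (hj : j ≤ k) {d : ℤ} {f : objQk k N ⟶ objQk k d}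
    (hf : f ∈ filt (homSq k N) j d) : DerivsVanish j (evalFundamental N k d f) := by
  induction hf using AddSubgroup.closure_induction with
  | mem x hx =>
    obtain ⟨a, h1, h2, y, rfl⟩ := hx
    rw [evalFundamental_homSq h1.le (by omega)]
    exact derivsVanish_polySq (by omega) (evalFundamental_isHomog y)
  | zero => rw [map_zero]; exact .zero j
  | add x y _ _ hx hy => rw [map_add]; exact hx.add hy
  | neg x _ hx => rw [map_neg]; exact hx.neg

/-- Converse to `derivsVanish_evalFundamental`; for j = 0 it is injectivity of evaluation on the
product of the variables. The induction is upward on the degree d and, inside it, downward on j from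
k. -/
theorem mem_filt_of_derivsVanish {j : ℕ} (hj : j ≤ k) {d : ℤ} (hd : j ≤ d)
    {f : objQk k N ⟶ objQk k d} (hf : DerivsVanish j (evalFundamental N k d f)) :
    f ∈ filt (homSq k N) j d := by
  obtain ⟨m, hm⟩ : ∃ m : ℕ, d < m := ⟨(d + 1).toNat, by omega⟩
  induction m generalizing d j with
  | zero => omega
  | succ m ihm =>
    by_cases hN : (N : ℤ) = d
    · subst hN
      obtain rfl | rfl := end_eq_zero_or_id f
      · exact zero_mem _
      · rw [evalFundamental_id] at hf
        have := not_derivsVanish_prod_X (Finset.univ : Finset (Fin N))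
        rw [Finset.card_univ, Fintype.card_fin] at this
        exact (this (hf.mono (by omega))).elim
    obtain ⟨r, hr⟩ := Nat.exists_eq_add_of_le hj
    induction r generalizing j with
    | zero =>
      obtain rfl : k = j := by omega
      exact hom_mem_filt hN f
    | succ r ihr =>
      -- For d = j the filtration has already stabilised, so `filt` at j equals `filt` at k.
      obtain hd' | hd' := hd.eq_or_lt
      · rw [← filt_eq_of_le (homSq k N) (by omega) (show (j : ℤ) ≤ k by omega)]
        exact hom_mem_filt hN f
      · have h1 := ihr (j := j + 1) (by omega) (by omega) (hf.mono (by omega)) (by omega)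
        push_cast at h1
        obtain h | ⟨a, ha, h2, y, hy⟩ := exists_of_mem_filt_add_one h1
        · exact h
        -- The order-j derivatives of the square of y vanish, hence so do those of y. As y has
        -- degree a < d, induction puts it in the filtration, which the square preserves.
        · have h3 := hf.add (derivsVanish_evalFundamental hj hy).neg
          rw [map_sub, neg_sub, add_sub_cancel, evalFundamental_homSq ha.le (by omega)] at h3
          have h4 := ihm hj (by omega) (h3.of_polySq (by omega) (evalFundamental_isHomog y))
            (by omega)
          rw [← h2] at h4
          have h5 := (homSq_isUnstableSystem k N).sq_mem ha (by omega) h4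
          rw [h2] at h5
          simpa using add_mem hy h5

theorem homSq_isRegularSystem (k : ℕ) (n : ℤ) : IsRegularSystem (homSq k n) k := by
  intro a b hab h0 hk f hf
  obtain hn | hn := lt_or_ge n 0
  · rw [← Category.id_comp f, id_eq_zero hn, zero_comp]
    exact zero_mem _
  · obtain ⟨N, rfl⟩ := Int.eq_ofNat_of_zero_le hn
    obtain ⟨j, hj⟩ := Int.eq_ofNat_of_zero_le h0
    rw [hj] at hf ⊢
    have h1 := derivsVanish_evalFundamental (by omega) hf
    rw [evalFundamental_homSq hab.le (by omega)] at h1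
    exact mem_filt_of_derivsVanish (by omega) (by omega)
      (h1.of_polySq (by omega) (evalFundamental_isHomog f))

end Regularity

/-! ### Exactness is tested objectwise. -/

section Exactness

variable (C : Type u) [Category.{v} C] [Preadditive C]

instance : PreservesFiniteLimits (additiveFunctor C AddCommGrpCat.{w}).ι :=
  have := fun {X Y} (f : X ⟶ Y) => (additiveFunctor C AddCommGrpCat.{w}).preservesKernels_ι f
  Functor.preservesFiniteLimits_of_preservesKernels _

instance : PreservesFiniteColimits (additiveFunctor C AddCommGrpCat.{w}).ι :=
  have := fun {X Y} (f : X ⟶ Y) => (additiveFunctor C AddCommGrpCat.{w}).preservesCokernels_ι f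
  Functor.preservesFiniteColimits_of_preservesCokernels _

/-- Evaluation of modules over a ringoid at an object. -/
abbrev evalFunctor (x : C) : RingoidModule.{u, v, w} C ⥤ AddCommGrpCat.{w} :=
  (additiveFunctor C AddCommGrpCat.{w}).ι ⋙ (evaluation C _).obj x

variable {C}

theorem surjective_of_epi {M N : RingoidModule.{u, v, w} C} (f : M ⟶ N) [Epi f] (x : C) :
    Function.Surjective (f.hom.app x).hom :=
  (AddCommGrpCat.epi_iff_surjective _).1 (inferInstanceAs (Epi ((evalFunctor C x).map f)))

theorem epi_of_surjective {M N : RingoidModule.{u, v, w} C} (f : M ⟶ N)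
    (h : ∀ x, Function.Surjective (f.hom.app x).hom) : Epi f := by
  have : ∀ x, Epi (f.hom.app x) := fun x => (AddCommGrpCat.epi_iff_surjective _).2 (h x)
  have : Epi f.hom := NatTrans.epi_of_epi_app _
  exact (additiveFunctor C AddCommGrpCat.{w}).ι.epi_of_epi_map this

end Exactness

/-! ### Graded pieces of modules, and free modules. -/

section Modules

variable {k : ℕ}

/-- The degree `n` part of a module. -/
abbrev modDeg (M : Uk.{u} k) (n : ℤ) : Type u := M.obj.obj (objQk k n)

/-- The action of morphisms of `Qk k` on a module. -/
noncomputable def modAct (M : Uk.{u} k) (a b : ℤ) :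
    (objQk k a ⟶ objQk k b) →+ (modDeg M a →+ modDeg M b) where
  toFun f := (M.obj.map f).hom
  map_zero' := by rw [Functor.map_zero]; rfl
  map_add' f g := by rw [Functor.map_add]; rfl

/-- The squares acting on a module. -/
noncomputable def modSq (M : Uk.{u} k) (a b : ℤ) : modDeg M a →+ modDeg M b :=
  modAct M a b (topSq k a b)

theorem modAct_comp (M : Uk.{u} k) (a b c : ℤ) (f : objQk k a ⟶ objQk k b)
    (g : objQk k b ⟶ objQk k c) (x : modDeg M a) :
    modAct M a c (f ≫ g) x = modAct M b c g (modAct M a b f x) := by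
  change (M.obj.map (f ≫ g)).hom x = _
  rw [Functor.map_comp]
  rfl

theorem modAct_id (M : Uk.{u} k) (a : ℤ) (x : modDeg M a) : modAct M a a (𝟙 _) x = x := by
  change (M.obj.map (𝟙 _)).hom x = _
  rw [CategoryTheory.Functor.map_id]
  rfl

theorem modSq_isUnstableSystem (M : Uk.{u} k) : IsUnstableSystem (modSq M) k :=
  isUnstableSystem_of_action (modAct M) (modAct_comp M)

theorem modDeg_eq_zero (M : Uk.{u} k) {n : ℤ} (hn : n < 0) (x : modDeg M n) : x = 0 := by
  rw [← modAct_id M n x, id_eq_zero hn, map_zero, AddMonoidHom.zero_apply]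

theorem modDeg_two_nsmul (M : Uk.{u} k) {n : ℤ} (x : modDeg M n) : 2 • x = 0 := by
  rw [← modAct_id M n x, ← AddMonoidHom.nsmul_apply, ← map_nsmul, two_nsmul, add_self_eq_zero,
    map_zero, AddMonoidHom.zero_apply]

/-- The components of a map of modules. -/
noncomputable def modMap {M N : Uk.{u} k} (f : M ⟶ N) (n : ℤ) : modDeg M n →+ modDeg N n :=
  (f.hom.app (objQk k n)).hom

theorem modMap_modAct {M N : Uk.{u} k} (f : M ⟶ N) (a b : ℤ) (g : objQk k a ⟶ objQk k b)
    (x : modDeg M a) : modMap f b (modAct M a b g x) = modAct N a b g (modMap f a x) :=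
  congrArg (fun φ => φ.hom x) (f.hom.naturality g)

theorem modMap_modSq {M N : Uk.{u} k} (f : M ⟶ N) (a b : ℤ) (x : modDeg M a) :
    modMap f b (modSq M a b x) = modSq N a b (modMap f a x) :=
  modMap_modAct f a b _ x

theorem modMap_hom_ext {M N : Uk.{u} k} {f g : M ⟶ N} (h : ∀ n x, modMap f n x = modMap g n x) :
    f = g := by
  refine ObjectProperty.hom_ext _ (NatTrans.ext (funext fun x => ?_))
  exact AddCommGrpCat.hom_ext
    (AddMonoidHom.ext (h (show Degree from (show FreeSquares from x.obj.as)).val))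

variable {S : ShortComplex (Uk.{u} k)}

theorem modMap_injective (hS : S.ShortExact) (n : ℤ) : Function.Injective (modMap S.f n) :=
  (AddCommGrpCat.mono_iff_injective _).1 (hS.map_of_exact (evalFunctor _ (objQk k n))).mono_f

theorem modMap_surjective (hS : S.ShortExact) (n : ℤ) : Function.Surjective (modMap S.g n) :=
  (AddCommGrpCat.epi_iff_surjective _).1 (hS.map_of_exact (evalFunctor _ (objQk k n))).epi_g

theorem modMap_exact (hS : S.ShortExact) (n : ℤ) (x : modDeg S.X₂ n) :
    modMap S.g n x = 0 ↔ ∃ y, modMap S.f n y = x :=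
  (ShortComplex.ab_exact_iff_function_exact _).1
    (hS.map_of_exact (evalFunctor _ (objQk k n))).exact x

theorem isRegularSystem_of_shortExact (hS : S.ShortExact) {l : ℕ} (hl : l < k)
    (h₂ : IsRegularSystem (modSq S.X₂) k) (h₃ : IsRegularSystem (modSq S.X₃) l) :
    IsRegularSystem (modSq S.X₁) (l + 1 : ℕ) :=
  IsRegularSystem.of_shortExact (modMap S.f) (modMap_modSq S.f) (modMap_injective hS) (modMap S.g)
    (modMap_modSq S.g) (modMap_surjective hS) (modMap_exact hS) (modSq_isUnstableSystem _)
    (by exact_mod_cast hl) h₂ h₃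

section Free

variable (k) {I : Type u} (deg : I → ℤ)

/-- The functor underlying a free module. -/
noncomputable def freeFunctor : Qk k ⥤ AddCommGrpCat.{u} where
  obj X := AddCommGrpCat.of (Π₀ α, (objQk k (deg α) ⟶ X))
  map g := AddCommGrpCat.ofHom (DFinsupp.mapRange.addMonoidHom fun _ => Preadditive.rightComp _ g)
  map_id _ := AddCommGrpCat.hom_ext (AddMonoidHom.ext fun f => DFinsupp.ext fun α =>
    Category.comp_id (f α))
  map_comp g h := AddCommGrpCat.hom_ext (AddMonoidHom.ext fun f => DFinsupp.ext fun α =>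
    (Category.assoc (f α) g h).symm)

instance : (freeFunctor k deg).Additive where
  map_add {X _ g h} := AddCommGrpCat.hom_ext (AddMonoidHom.ext fun
    (f : Π₀ α, (objQk k (deg α) ⟶ X)) => DFinsupp.ext fun α =>
    Preadditive.comp_add _ _ _ (f α) g h)

/-- The free module on generators `α : I` of degrees `deg α`. -/
noncomputable def freeMod : Uk.{u} k := AdditiveFunctor.of (freeFunctor k deg)

variable {k} {deg}

/-- The component of an element of a free module at a generator. -/
noncomputable def freeMod.coord (α : I) (d : ℤ) :
    modDeg (freeMod k deg) d →+ (objQk k (deg α) ⟶ objQk k d) :=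
  DFinsupp.evalAddMonoidHom α

open Classical in
/-- The multiples of a generator of a free module. -/
noncomputable def freeMod.single (α : I) (d : ℤ) :
    (objQk k (deg α) ⟶ objQk k d) →+ modDeg (freeMod k deg) d :=
  DFinsupp.singleAddHom (fun α => (objQk k (deg α) ⟶ objQk k d)) α

theorem freeMod.coord_modSq (α : I) (a b : ℤ) (x : modDeg (freeMod k deg) a) :
    coord α b (modSq _ a b x) = homSq k (deg α) a b (coord α a x) := rfl

theorem freeMod.coord_single_same (α : I) (d : ℤ) (f : objQk k (deg α) ⟶ objQk k d) :
    coord α d (single α d f) = f := by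
  classical exact DFinsupp.single_eq_same (β := fun α => (objQk k (deg α) ⟶ objQk k d))

theorem freeMod.coord_single_of_ne {α β : I} (h : α ≠ β) (d : ℤ)
    (f : objQk k (deg β) ⟶ objQk k d) : coord α d (single β d f) = 0 := by
  classical exact DFinsupp.single_eq_of_ne (β := fun α => (objQk k (deg α) ⟶ objQk k d)) h

theorem freeMod.modAct_single (α : I) (a b : ℤ) (f : objQk k (deg α) ⟶ objQk k a)
    (g : objQk k a ⟶ objQk k b) :
    modAct (freeMod k deg) a b g (single α a f) = single α b (f ≫ g) := by
  classical exact DFinsupp.mapRange_single (hf := fun _ => map_zero _)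

theorem freeMod.single_homSq (α : I) (a b : ℤ) (f : objQk k (deg α) ⟶ objQk k a) :
    single α b (homSq k (deg α) a b f) = modSq (freeMod k deg) a b (single α a f) :=
  (modAct_single α a b f _).symm

/-- Squares act coordinatewise, so regularity of a free module reduces to that of the representable
ones. -/
theorem freeMod.mem_filt_iff {i d : ℤ} (x : modDeg (freeMod k deg) d) :
    x ∈ filt (modSq (freeMod k deg)) i d ↔ ∀ α, coord α d x ∈ filt (homSq k (deg α)) i d := by
  classical
  refine ⟨fun h α => map_mem_filt (coord α) (coord_modSq α) h, fun h => ?_⟩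
  have hx : x = ∑ α ∈ DFinsupp.support x, single α d (coord α d x) :=
    (DFinsupp.sum_single (f := x)).symm
  rw [hx]
  exact sum_mem fun α _ => map_mem_filt (single α) (single_homSq α) (h α)

theorem freeMod.isRegularSystem : IsRegularSystem (modSq (freeMod k deg)) k := by
  intro a b h1 h2 h3 x hx
  rw [mem_filt_iff] at hx ⊢
  exact fun α => homSq_isRegularSystem k _ a b h1 h2 h3 _ (hx α)

theorem freeMod.addHom_ext {d : ℤ} {G : Type*} [AddCommGroup G]
    {φ ψ : modDeg (freeMod k deg) d →+ G}
    (h : ∀ α f, φ (single α d f) = ψ (single α d f)) : φ = ψ := by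
  classical
  exact DFinsupp.addHom_ext h

open Classical in
/-- The components of the map from a free module determined by the images of the generators. -/
noncomputable def freeMod.liftApp (M : Uk.{u} k) (m : ∀ α, modDeg M (deg α)) (d : Qk k) :
    (Π₀ α, (objQk k (deg α) ⟶ d)) →+ M.obj.obj d :=
  DFinsupp.liftAddHom fun α =>
    { toFun := fun f => (M.obj.map f).hom (m α)
      map_zero' := by rw [Functor.map_zero]; rfl
      map_add' := fun f g => by rw [Functor.map_add]; rfl }

open Classical in
theorem freeMod.liftApp_single (M : Uk.{u} k) (m : ∀ α, modDeg M (deg α)) (d : Qk k) (α : I)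
    (f : objQk k (deg α) ⟶ d) :
    liftApp M m d (DFinsupp.single α f) = (M.obj.map f).hom (m α) :=
  DFinsupp.liftAddHom_apply_single _ _ _

/-- The map from a free module determined by the images of the generators. -/
noncomputable def freeMod.lift (M : Uk.{u} k) (m : ∀ α, modDeg M (deg α)) :
    freeMod k deg ⟶ M :=
  ObjectProperty.homMk
    { app := fun X => AddCommGrpCat.ofHom (liftApp M m X)
      naturality := fun X Y g => by
        classical
        refine AddCommGrpCat.hom_ext (DFinsupp.addHom_ext
          (β := fun α => (objQk k (deg α) ⟶ X)) fun α f => ?_)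
        change liftApp M m Y (DFinsupp.mapRange
            (fun α (f : objQk k (deg α) ⟶ X) => f ≫ g) (fun _ => zero_comp) (DFinsupp.single α f)) =
          (M.obj.map g).hom (liftApp M m X (DFinsupp.single α f))
        rw [DFinsupp.mapRange_single, liftApp_single, liftApp_single]
        rw [Functor.map_comp]
        rfl }

theorem freeMod.lift_single (M : Uk.{u} k) (m : ∀ α, modDeg M (deg α)) (α : I) (d : ℤ)
    (f : objQk k (deg α) ⟶ objQk k d) :
    modMap (lift M m) d (single α d f) = modAct M _ _ f (m α) :=
  liftApp_single M m _ α f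

theorem freeMod.hom_ext {M : Uk.{u} k} {φ ψ : freeMod k deg ⟶ M}
    (h : ∀ α, modMap φ _ (single α _ (𝟙 _)) = modMap ψ _ (single α _ (𝟙 _))) : φ = ψ := by
  refine modMap_hom_ext fun n => DFunLike.congr_fun (addHom_ext fun α f => ?_)
  rw [← Category.id_comp f, ← modAct_single, modMap_modAct, modMap_modAct, h]

instance freeMod.projective : Projective (freeMod k deg) where
  factors {E X} f e _ := by
    choose m hm using fun α => surjective_of_epi e _ (modMap f _ (single α _ (𝟙 _)))
    refine ⟨lift E m, hom_ext fun α => ?_⟩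
    change modMap e _ (modMap (lift E m) _ _) = _
    rw [lift_single, modAct_id]
    exact hm α

end Free

end Modules

/-! ### Regular modules are free. -/

section Freeness

/-- The `m b` lift an 𝔽₂-basis of G/H and the `c b` are its coordinates. It is applied to the
indecomposables of a module, its quotient by `filt` at k. -/
theorem exists_basis_mod {G : Type u} [AddCommGroup G] (hG : ∀ x : G, 2 • x = 0)
    (H : AddSubgroup G) : ∃ (B : Type u) (m : B → G) (c : B → G →+ ZMod 2),
      (∀ b, ∀ x ∈ H, c b x = 0) ∧ (∀ b, c b (m b) = 1) ∧ (∀ b b', b ≠ b' → c b (m b') = 0) ∧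
        AddSubgroup.closure (Set.range m) ⊔ H = ⊤ := by
  let : Module (ZMod 2) (G ⧸ H) := AddCommGroup.zmodModule fun x => by
    obtain ⟨x, rfl⟩ := QuotientAddGroup.mk_surjective x
    rw [← QuotientAddGroup.mk_nsmul, hG]
    rfl
  let e := Module.Free.chooseBasis (ZMod 2) (G ⧸ H)
  choose m hm using fun b => QuotientAddGroup.mk_surjective (e b)
  refine ⟨_, m, fun b => (e.coord b).toAddMonoidHom.comp (QuotientAddGroup.mk' H), ?_, ?_, ?_, ?_⟩
  · intro b x hx
    change e.coord b (x : G ⧸ H) = 0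
    rw [(QuotientAddGroup.eq_zero_iff x).2 hx, map_zero]
  · intro b
    change e.coord b (m b : G ⧸ H) = 1
    rw [hm, e.coord_apply, e.repr_self, Finsupp.single_eq_same]
  · intro b b' hb
    change e.coord b (m b' : G ⧸ H) = 0
    rw [hm, e.coord_apply, e.repr_self, Finsupp.single_eq_of_ne hb]
  · rw [eq_top_iff]
    intro x _
    have hx : (x : G ⧸ H) ∈ AddSubgroup.toZModSubmodule 2
        ((AddSubgroup.closure (Set.range m)).map (QuotientAddGroup.mk' H)) := by
      refine Submodule.span_le.2 ?_ (e.mem_span (x : G ⧸ H))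
      rintro _ ⟨b, rfl⟩
      exact ⟨m b, AddSubgroup.subset_closure ⟨b, rfl⟩, hm b⟩
    obtain ⟨y, hy, hyx⟩ := hx
    rw [← add_sub_cancel y x]
    refine add_mem (AddSubgroup.mem_sup_left hy) (AddSubgroup.mem_sup_right ?_)
    have := (QuotientAddGroup.eq (s := H)).1 hyx
    rwa [neg_add_eq_sub] at this

open Classical in
/-- The coefficient of the identity in an endomorphism of a degree. -/
noncomputable def endCoeff (k : ℕ) (d : ℤ) : (objQk k d ⟶ objQk k d) →+ ZMod 2 where
  toFun f := if f = 0 then 0 else 1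
  map_zero' := if_pos rfl
  map_add' f g := by
    obtain rfl | rfl := end_eq_zero_or_id f
    · simp
    · obtain rfl | rfl := end_eq_zero_or_id g
      · simp
      · rw [add_self_eq_zero, if_pos rfl]
        split_ifs <;> rfl

theorem eq_zero_of_endCoeff {k : ℕ} {d : ℤ} {f : objQk k d ⟶ objQk k d}
    (h : endCoeff k d f = 0) : f = 0 := by
  by_contra hf
  have : endCoeff k d f = 1 := if_neg hf
  exact one_ne_zero (this.symm.trans h)

theorem endCoeff_id {k : ℕ} {d : ℤ} (h : 𝟙 (objQk k d) ≠ 0) : endCoeff k d (𝟙 _) = 1 := if_neg h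

variable {k : ℕ}

theorem modAct_mem_filt (M : Uk.{u} k) {n d i : ℤ} (m : modDeg M n)
    {f : objQk k n ⟶ objQk k d} (hf : f ∈ filt (homSq k n) i d) :
    modAct M n d f m ∈ filt (modSq M) i d :=
  map_mem_filt (fun d => (AddMonoidHom.eval m).comp (modAct M n d))
    (fun _ _ _ => modAct_comp M _ _ _ _ _ _) hf

theorem projective_of_isRegularSystem (M : Uk.{u} k) (hM : IsRegularSystem (modSq M) k) :
    Projective M := by
  choose B m c hc h1 h0 hspan using fun d : ℤ =>
    exists_basis_mod (fun x => modDeg_two_nsmul M (n := d) x) (filt (modSq M) k d)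
  let deg : (Σ d, B d) → ℤ := fun α => α.1
  let φ : freeMod k deg ⟶ M := freeMod.lift M fun α => m α.1 α.2
  have hφ : ∀ (α : Σ d, B d) (d : ℤ) (f : objQk k (deg α) ⟶ objQk k d),
      modMap φ d (freeMod.single α d f) = modAct M _ _ f (m α.1 α.2) := freeMod.lift_single M _
  -- Induction on degree: modulo the chosen generators, everything is a sum of squares of elements
  -- of lower degree.
  have hsurj : ∀ d, Function.Surjective (modMap φ d) := by
    intro d
    obtain ⟨N, hN⟩ : ∃ N : ℕ, d < N := ⟨(d + 1).toNat, by omega⟩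
    induction N generalizing d with
    | zero => exact fun x => ⟨0, (map_zero _).trans (modDeg_eq_zero M hN x).symm⟩
    | succ N ih =>
      rw [← AddMonoidHom.range_eq_top, eq_top_iff, ← hspan d, sup_le_iff, filt,
        AddSubgroup.closure_le, AddSubgroup.closure_le]
      constructor
      · rintro _ ⟨b, rfl⟩
        exact ⟨freeMod.single ⟨d, b⟩ d (𝟙 _), (hφ _ _ _).trans (modAct_id _ _ _)⟩
      · rintro _ ⟨a, ha, -, x, rfl⟩
        obtain ⟨y, rfl⟩ := ih a (by push_cast at hN; omega) x
        exact ⟨modSq _ a d y, modMap_modSq φ _ _ _⟩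
  -- Only the identity components of a free element survive modulo `filt` at k, so φ is injective on
  -- indecomposables.
  have hcoord : ∀ d (b : B d), (c d b).comp (modMap φ d) =
      (endCoeff k d).comp (freeMod.coord (⟨d, b⟩ : Σ d, B d) d) := by
    intro d b
    refine freeMod.addHom_ext fun α f => ?_
    rw [AddMonoidHom.comp_apply, AddMonoidHom.comp_apply, hφ]
    obtain ⟨n, b'⟩ := α
    by_cases hn : n = d
    · subst hn
      obtain hf | hf := end_eq_zero_or_id f
      · rw [hf]
        simp only [map_zero, AddMonoidHom.zero_apply]
      -- The identity is zero in negative degrees, where `endCoeff` cannot take the value 1.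
      · by_cases hid : 𝟙 (objQk k n) = 0
        · rw [hf, hid]
          simp only [map_zero, AddMonoidHom.zero_apply]
        · rw [hf, modAct_id]
          by_cases hb : b = b'
          · subst hb
            rw [h1, freeMod.coord_single_same, endCoeff_id hid]
          · rw [h0 _ _ _ hb, freeMod.coord_single_of_ne, map_zero]
            simpa using hb
    · rw [hc d b _ (modAct_mem_filt M _ (hom_mem_filt hn f)), freeMod.coord_single_of_ne, map_zero]
      rintro h
      exact hn (congrArg Sigma.fst h).symm
  have hfilt : ∀ d (x : modDeg (freeMod k deg) d), modMap φ d x = 0 →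
      x ∈ filt (modSq (freeMod k deg)) k d := by
    intro d x hx
    rw [freeMod.mem_filt_iff]
    rintro ⟨n, b⟩
    by_cases hn : n = d
    · subst hn
      have := DFunLike.congr_fun (hcoord n b) x
      rw [AddMonoidHom.comp_apply, hx, map_zero] at this
      rw [eq_zero_of_endCoeff this.symm]
      exact zero_mem _
    · exact hom_mem_filt hn _
  have : Epi φ := epi_of_surjective φ fun X =>
    hsurj (show Degree from (show FreeSquares from X.obj.as)).val
  have hS : (ShortComplex.mk (kernel.ι φ) φ (kernel.condition φ)).ShortExact :=
    { exact := ShortComplex.exact_of_f_is_kernel _ (kernelIsKernel φ) }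
  -- A Nakayama argument: the kernel lies in `filt` at k of the free module, and by regularity of M
  -- this is induced on the kernel. So the kernel equals its own `filt` at k and vanishes by
  -- induction on degree.
  have hK : ∀ d (x : modDeg (kernel φ) d), x = 0 := by
    intro d x
    obtain ⟨N, hN⟩ : ∃ N : ℕ, d < N := ⟨(d + 1).toNat, by omega⟩
    induction N generalizing d with
    | zero => exact modDeg_eq_zero _ hN x
    | succ N ih =>
      have hx : x ∈ filt (modSq (kernel φ)) k d :=
        mem_filt_of_map_mem_filt (modMap (kernel.ι φ)) (modMap_modSq _) (modMap_injective hS)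
          (modMap φ) (modMap_modSq _) hsurj (modMap_exact hS) (modSq_isUnstableSystem _) le_rfl hM
          (hfilt d _ ((modMap_exact hS d _).2 ⟨x, rfl⟩))
      have h : filt (modSq (kernel φ)) k d ≤ ⊥ := by
        rw [filt, AddSubgroup.closure_le]
        rintro _ ⟨a, ha, -, y, rfl⟩
        rw [ih a y (by push_cast at hN; omega), map_zero]
        exact zero_mem _
      exact h hx
  have : Mono φ := hS.exact.mono_g (modMap_hom_ext fun n x => by
    rw [hK n x, map_zero, map_zero])
  have : IsIso φ := isIso_of_mono_of_epi φ
  exact Projective.of_iso (asIso φ) inferInstance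

end Freeness

/-! ### Splicing a projective resolution of the kernel onto a projective cover term. -/

section Splicing

variable {A : Type u} [Category.{v} A] [Abelian A] {S : ShortComplex A} (hS : S.ShortExact)
  (P : ProjectiveResolution S.X₁)

/-- The augmentation of a projective resolution. -/
noncomputable def resolutionAug : P.complex.X 0 ⟶ S.X₁ :=
  (ChainComplex.toSingle₀Equiv _ _ P.π).1

theorem d_comp_resolutionAug : P.complex.d 1 0 ≫ resolutionAug P = 0 :=
  (ChainComplex.toSingle₀Equiv _ _ P.π).2

instance : Epi (resolutionAug P) := inferInstanceAs (Epi (P.π.f 0))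

theorem exact_resolutionAug :
    (ShortComplex.mk (P.complex.d 1 0) (resolutionAug P) (d_comp_resolutionAug P)).Exact :=
  P.exact₀

/-- The complex obtained by splicing a resolution of `S.X₁` with `S.X₁ ⟶ S.X₂`. -/
noncomputable def splice : ChainComplex A ℕ :=
  P.complex.augment (resolutionAug P ≫ S.f) (by
    rw [← Category.assoc, d_comp_resolutionAug, zero_comp])

theorem splice_d_comp : (splice P).d 1 0 ≫ S.g = 0 :=
  (Category.assoc (resolutionAug P) S.f S.g).trans
    ((congrArg (resolutionAug P ≫ ·) S.zero).trans comp_zero)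

include hS in
theorem splice_exact_zero : (ShortComplex.mk ((splice P).d 1 0) S.g (splice_d_comp P)).Exact := by
  let α : ShortComplex.mk ((splice P).d 1 0) S.g (splice_d_comp P) ⟶ S :=
    { τ₁ := resolutionAug P
      τ₂ := 𝟙 _
      τ₃ := 𝟙 _
      comm₁₂ := (Category.comp_id _).symm
      comm₂₃ := (Category.id_comp _).trans (Category.comp_id _).symm }
  have : Epi α.τ₁ := inferInstanceAs (Epi (resolutionAug P))
  have : IsIso α.τ₂ := inferInstanceAs (IsIso (𝟙 _))
  have : Mono α.τ₃ := inferInstanceAs (Mono (𝟙 _))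
  exact (ShortComplex.exact_iff_of_epi_of_isIso_of_mono α).2 hS.exact

include hS in
theorem splice_exactAt_succ (n : ℕ) : (splice P).ExactAt (n + 1) := by
  rw [HomologicalComplex.exactAt_iff' _ (n + 1 + 1) (n + 1) n (by simp) (by simp)]
  match n with
  | 0 =>
    let α : ShortComplex.mk (P.complex.d 1 0) (resolutionAug P) (d_comp_resolutionAug P) ⟶
        (splice P).sc' 2 1 0 :=
      { τ₁ := 𝟙 _
        τ₂ := 𝟙 _
        τ₃ := S.f
        comm₁₂ := (Category.id_comp _).trans (Category.comp_id _).symm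
        comm₂₃ := Category.id_comp _ }
    have : Epi α.τ₁ := inferInstanceAs (Epi (𝟙 _))
    have : IsIso α.τ₂ := inferInstanceAs (IsIso (𝟙 _))
    have : Mono α.τ₃ := hS.mono_f
    exact (ShortComplex.exact_iff_of_epi_of_isIso_of_mono α).1 (exact_resolutionAug P)
  | n + 1 => exact P.exact_succ n

/-- The projective resolution obtained by splicing. -/
noncomputable def spliceResolution [Projective S.X₂] : ProjectiveResolution S.X₃ where
  complex := splice P
  projective n := match n with
    | 0 => inferInstanceAs (Projective S.X₂)
    | n + 1 => P.projective n
  π := (ChainComplex.toSingle₀Equiv _ _).symm ⟨S.g, splice_d_comp P⟩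
  quasiIso := ⟨fun n => by
    cases n
    · rw [ChainComplex.quasiIsoAt₀_iff, ShortComplex.quasiIso_iff_of_zeros']
      · refine (ShortComplex.exact_and_epi_g_iff_of_iso ?_).2 ⟨splice_exact_zero hS P, hS.epi_g⟩
        exact ShortComplex.isoMk (Iso.refl _) (Iso.refl _) (Iso.refl _)
          ((Category.id_comp _).trans (Category.comp_id _).symm)
          ((Category.id_comp _).trans ((ChainComplex.toSingle₀Equiv_symm_apply_f_zero
            (C := splice P) S.g (splice_d_comp P)).symm.trans (Category.comp_id _).symm))
      all_goals rfl
    · rw [quasiIsoAt_iff_exactAt']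
      · exact splice_exactAt_succ hS P _
      · apply ChainComplex.exactAt_succ_single_obj⟩

/-- A projective object resolves itself. -/
theorem exists_resolution_of_projective (X : A) [Projective X] :
    ∃ P : ProjectiveResolution X, ∀ n : ℕ, 0 < n → IsZero (P.complex.X n) :=
  ⟨ProjectiveResolution.self X, fun n hn => by
    obtain ⟨n, rfl⟩ := Nat.exists_eq_add_of_lt hn
    exact HomologicalComplex.isZero_single_obj_X _ _ _ _ (by omega)⟩

end Splicing

/-! ### Dimension shifting. -/

section Main

variable {k : ℕ}

/-- Every module is the quotient of a free module. -/
theorem exists_shortExact_freeMod (M : Uk.{u} k) :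
    ∃ (S : ShortComplex (Uk.{u} k)), S.ShortExact ∧ S.X₃ = M ∧ Projective S.X₂ ∧
      IsRegularSystem (modSq S.X₂) k := by
  -- There is one generator for every homogeneous element of M, so surjectivity is immediate.
  let φ : freeMod k (fun α : Σ n, modDeg M n => α.1) ⟶ M := freeMod.lift M fun α => α.2
  have : Epi φ := epi_of_surjective φ fun X x =>
    ⟨freeMod.single ⟨(show Degree from (show FreeSquares from X.obj.as)).val, x⟩ _ (𝟙 _),
      (freeMod.lift_single _ _ _ _ _).trans (modAct_id _ _ _)⟩
  exact ⟨ShortComplex.mk (kernel.ι φ) φ (kernel.condition φ),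
    { exact := ShortComplex.exact_of_f_is_kernel _ (kernelIsKernel φ) }, rfl,
    freeMod.projective, freeMod.isRegularSystem⟩

/-- Here r = k - l counts the missing regularity. The kernel of a free cover is missing one less,
and for r = 0 the module is projective. -/
theorem dimension_of_isRegularSystem {l r : ℕ} (hlr : l + r = k) (M : Uk.{u} k)
    (hM : IsRegularSystem (modSq M) l) : HasProjectiveDimensionLT M (r + 1) ∧
      ∃ P : ProjectiveResolution M, ∀ n : ℕ, r < n → IsZero (P.complex.X n) := by
  induction r generalizing l M with
  | zero =>
    obtain rfl : l = k := by omega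
    have := projective_of_isRegularSystem M hM
    exact ⟨inferInstance, exists_resolution_of_projective M⟩
  | succ r ih =>
    obtain ⟨S, hS, rfl, hP, hreg⟩ := exists_shortExact_freeMod M
    obtain ⟨h1, P, h2⟩ := ih (l := l + 1) (by omega) S.X₁
      (isRegularSystem_of_shortExact hS (by omega) hreg hM)
    refine ⟨hS.hasProjectiveDimensionLT_X₃ _ h1 (hasProjectiveDimensionLT_of_ge _ 1 _ (by omega)),
      spliceResolution hS P, fun n hn => ?_⟩
    obtain ⟨n, rfl⟩ := Nat.exists_eq_add_of_lt hn
    exact h2 _ (by omega)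

end Main

end TopSquares

theorem mainTheorem1 (k : ℕ) :
    (∀ (M N : TopSquares.Uk.{u} k) (s : ℕ), k < s → Subsingleton (Abelian.Ext M N s)) ∧
      (∀ M : TopSquares.Uk.{u} k, ∃ P : ProjectiveResolution M,
        ∀ n : ℕ, k < n → IsZero (P.complex.X n)) := by
  -- No lower index is both nonnegative and less than 0.
  have h0 : ∀ M : TopSquares.Uk.{u} k, TopSquares.IsRegularSystem (TopSquares.modSq M) (0 : ℕ) :=
    fun M a b _ h1 h2 => absurd h1 (not_le.2 h2)
  have h := fun M : TopSquares.Uk.{u} k =>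
    TopSquares.dimension_of_isRegularSystem (zero_add k) M (h0 M)
  refine ⟨fun M N s hs => ?_, fun M => (h M).2⟩
  have := (h M).1
  exact HasProjectiveDimensionLT.subsingleton M (k + 1) s hs N
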